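/- For $d>0$ let $\mathrm{Poisson}(d)$ be the random rooted tree in which the numbers of children of the vertices are independent and Poisson distributed with mean $d$. For a locally finite graph $G$, a fugacity $\lambda\in(0,\infty)$, a finite vertex set $\Psi$, a set $B\subseteq\Psi$ and an independent set $\sigma\subseteq B$, let $\mu_{\Psi,B}^{\sigma}$ be the hard-core measure on independent sets $S\subseteq\Psi$ (probability proportional to $\lambda^{|S|}$), conditioned on $S\cap B=\sigma$. Let $\partial\Psi$ be the set of vertices of $\Psi$ that have a neighbour outside $\Psi$. The hard-core model on $G$ has *weak spatial mixing* (WSM) if, for every finite $\Lambda$, the total variation distance on $\Lambda$ between $\mu_{\Psi,\partial\Psi}^{\sigma}$ and $\mu_{\Psi,\partial\Psi}^{\tau}$ tends to $0$, uniformly over finite $\Psi\supseteq\Lambda$ and independent $\sigma,\tau\subseteq\partial\Psi$, as $\mathrm{dist}(\Lambda,\partial\Psi)\to\infty$. It has *strong spatial mixing* (SSM) if, for every finite $\Lambda$, the total variation distance on $\Lambda$ between $\mu_{\Psi,B}^{\sigma}$ and $\mu_{\Psi,B}^{\tau}$ tends to $0$, uniformly over finite $\Psi\supseteq\Lambda$,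 frozen sets $B$ with $\partial\Psi\subseteq B\subseteq\Psi$ and independent $\sigma,\tau\subseteq B$, as $\mathrm{dist}(\Lambda,\sigma\oplus\tau)\to\infty$, where $\sigma\oplus\tau$ is the set of vertices on which $\sigma$ and $\tau$ differ. **Theorem.** In the following, "a.s." means almost surely for the tree $\mathrm{Poisson}(d)$, conditioned on being infinite. 1. There is a number $d^*\in(1.179,1.180)$ such that, for $x>0$, $\frac{1+e^{-xe^{-x}}}{2}<\frac1x$ holds if and only if $x<d^*$, and for every $0<d<d^*$, a.s. the hard-core model has WSM for all $\lambda\in(0,\infty)$. 2. For all $d>0$ and $\lambda>0$, the hard-core model with fugacity $\lambda$ has SSM a.s. if $$\lambda<\begin{cases}\dfrac{4d^2}{(d^2-1)^2}&\text{when } d<\sqrt{2+\sqrt5},\\[2mm] \dfrac{3+\sqrt{1+4d^2}}{2d^2-4}&\text{otherwise.}\end{cases}$$ 3. For every $\gamma\in(0,1)$ there is $d_0$ such that for all $d>d_0$ and all $0<\lambda\le(1-\gamma)e/d$, the hard-core model with fugacity $\lambda$ has WSM a.s. 4. For every $c>e$ there is $d_0$ such that for all $d>d_0$, the hard-core model with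 fugacity $\lambda=c/d$ a.s. does not have WSM. (For $d\le1$ the tree is almost surely finite, so the conditional statements have content only for $d>1$.) -/

import Mathlib

open MeasureTheory ProbabilityTheory
open scoped NNReal ENNReal

/-! ### The hard-core model on a graph, and spatial mixing -/

namespace HardCore

/-- The boundary of a finite set `Ψ` of vertices: the vertices of `Ψ` that have a neighbour
outside `Ψ`. -/
noncomputable def boundary {V : Type*} (G : SimpleGraph V) (Ψ : Finset V) : Finset V :=
  open scoped Classical in Ψ.filter (fun v => ∃ w, G.Adj v w ∧ w ∉ Ψ)

/-- A configuration on a finite set `B` of vertices is given by its set `σ` of occupied vertices;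
it is a (feasible) boundary condition if `σ` is an independent set of the graph. -/
def IsBoundaryCondition {V : Type*} (G : SimpleGraph V) (B σ : Finset V) : Prop :=
  σ ⊆ B ∧ G.IsIndepSet (σ : Set V)

/-- The independent sets `S ⊆ Ψ` that agree with `σ` on `B`. -/
noncomputable def configs {V : Type*} (G : SimpleGraph V) (Ψ B σ : Finset V) :
    Finset (Finset V) :=
  open scoped Classical in
  Ψ.powerset.filter (fun S => G.IsIndepSet (S : Set V) ∧ S ∩ B = σ)

/-- The partition function of the hard-core model with fugacity `lam` on `Ψ`, conditioned on
agreeing with `σ` on `B`. -/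
noncomputable def partitionFunction {V : Type*} (G : SimpleGraph V) (lam : ℝ)
    (Ψ B σ : Finset V) : ℝ :=
  ∑ S ∈ configs G Ψ B σ, lam ^ S.card

/-- The marginal on `Λ` of the hard-core model on `Ψ`, conditioned on agreeing with `σ` on `B`:
the conditional probability that the set of occupied vertices of `Λ` is `η`. -/
noncomputable def marginal {V : Type*} (G : SimpleGraph V) (lam : ℝ)
    (Ψ B σ Λ η : Finset V) : ℝ :=
  open scoped Classical in
  (∑ S ∈ (configs G Ψ B σ).filter (fun S => S ∩ Λ = η), lam ^ S.card) /
    partitionFunction G lam Ψ B σ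

/-- The total variation distance between the marginals on `Λ` of the two hard-core models on `Ψ`
that are conditioned on agreeing with `σ`, respectively `τ`, on `B`. -/
noncomputable def tvDist {V : Type*} (G : SimpleGraph V) (lam : ℝ)
    (Ψ B σ τ Λ : Finset V) : ℝ :=
  (1 / 2) * ∑ η ∈ Λ.powerset, |marginal G lam Ψ B σ Λ η - marginal G lam Ψ B τ Λ η|

/-- The graph distance between two finite sets of vertices (`⊤` if one of them is empty). -/
noncomputable def setDist {V : Type*} (G : SimpleGraph V) (A C : Finset V) : ℕ∞ :=
  ⨅ u ∈ A, ⨅ w ∈ C, G.edist u w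

/-- Weak spatial mixing: for every finite `Λ`, the effect on `Λ` of changing the boundary condition
on `∂Ψ` tends to zero as the distance from `Λ` to `∂Ψ` tends to infinity. -/
def WSM {V : Type*} (G : SimpleGraph V) (lam : ℝ) : Prop :=
  ∀ Λ : Finset V, ∀ ε : ℝ, 0 < ε → ∃ R : ℕ, ∀ Ψ : Finset V, Λ ⊆ Ψ →
    ∀ σ τ : Finset V,
      IsBoundaryCondition G (boundary G Ψ) σ → IsBoundaryCondition G (boundary G Ψ) τ →
      (R : ℕ∞) ≤ setDist G Λ (boundary G Ψ) →
      tvDist G lam Ψ (boundary G Ψ) σ τ Λ ≤ ε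

/-- Strong spatial mixing: for every finite `Λ`, the effect on `Λ` of changing the boundary
condition tends to zero as the distance from `Λ` to the set of vertices where the two boundary
conditions disagree tends to infinity. The frozen set `B` may be `∂Ψ`, or `∂Ψ` together with any
further vertices of `Ψ`, so that every vertex, also a leaf of the graph, can be frozen. -/
def SSM {V : Type*} (G : SimpleGraph V) (lam : ℝ) : Prop :=
  open scoped Classical in
  ∀ Λ : Finset V, ∀ ε : ℝ, 0 < ε → ∃ R : ℕ, ∀ Ψ : Finset V, Λ ⊆ Ψ →
    ∀ B : Finset V, boundary G Ψ ⊆ B → B ⊆ Ψ →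
    ∀ σ τ : Finset V, IsBoundaryCondition G B σ → IsBoundaryCondition G B τ →
      (R : ℕ∞) ≤ setDist G Λ (symmDiff σ τ) →
      tvDist G lam Ψ B σ τ Λ ≤ ε

end HardCore

/-! ### The Poisson tree -/

namespace PoissonTree

/-- Rooted trees are coded by offspring counts. The root is `[]`, the children of a vertex `v` are
`i :: v` with `i < N v`; `IsVertex N v` says that the label `v` occurs in the tree. -/
def IsVertex (N : List ℕ → ℕ) : List ℕ → Prop
  | [] => True
  | i :: v => IsVertex N v ∧ i < N v

/-- The tree with offspring counts `N`, as a graph: every vertex is joined to its children. -/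
def graph (N : List ℕ → ℕ) : SimpleGraph {v : List ℕ // IsVertex N v} where
  Adj u v := (∃ i, v.1 = i :: u.1) ∨ (∃ i, u.1 = i :: v.1)
  symm := ⟨fun _ _ h => h.symm⟩
  loopless := ⟨fun u h => by
    rcases h with ⟨i, hi⟩ | ⟨i, hi⟩ <;> exact absurd hi.symm (List.cons_ne_self i u.1)⟩

/-- The law of the Poisson tree of average arity `d`: the numbers of children of all the labels are
independent and Poisson distributed with mean `d`. -/
noncomputable def law (d : ℝ≥0) : Measure (List ℕ → ℕ) :=
  Measure.infinitePi (fun _ : List ℕ => poissonMeasure d)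

/-- The event that the tree is infinite. -/
def infiniteEvent : Set (List ℕ → ℕ) := {N | {v : List ℕ | IsVertex N v}.Infinite}

/-- The property `P` of the tree with offspring counts `N` holds almost surely for the Poisson tree
of average arity `d`, conditioned on being infinite. -/
def AlmostSurelyGivenInfinite (d : ℝ≥0) (P : (List ℕ → ℕ) → Prop) : Prop :=
  ∀ᵐ N ∂(ProbabilityTheory.cond (law d) infiniteEvent), P N

end PoissonTree

/-! On a forest the hard-core measure is a Markov chain run from the root downwards: a vertex with
an occupied parent is vacant, any other free vertex is vacant with probability `x v`. The messages
solve `x v = 1 / (1 + lam * ∏ x c)` over the children `c`, and equal 1 off the free vertices.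
Spatial mixing thus asks whether distant changes of the messages die out on the way to the root
(`marginal_eq`, `tvDist_le`, `le_tvDist_singleton`).

The recursion reverses order, so its iterates from the constants 1 and 0 form a decreasing and an
increasing sequence that enclose every message whose free set contains a large ball. For a fixed
tree, WSM holds exactly when the two limits agree at the root (`wsm_of_tight`,
`not_wsm_of_not_tight`).

Small mean: one step multiplies the summed gaps between the logarithms of the two limits by at most
1, and by at most 1/2 at a vertex with a leaf among its children, whatever the fugacity. The number
of non-leaves in generation `n`, damped by these halvings, has mean of geometric ratio `d (1 +
exp(-d exp(-d))) / 2`. If this ratio is below 1, the gap vanishes.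

Strong mixing: in the coordinate `arsinh √((1 - x) / x)` the partial derivatives of the recursion
are products `q * T i`, where `q` and `T i` are the square roots of the occupation probabilities of
parent and child. Bounding each product gives an ℓ¹ contraction (`contracts_abs`) that must beat the
growth `d ^ n` of the generations; this produces the two explicit thresholds. Cauchy-Schwarz over
all children and `s * exp(-s) ≤ exp(-1)` give instead a contraction of squares by `lam / e`
(`contracts_sq`), hence mixing for `lam < e / d`.

Non-uniqueness: the Poisson generating function turns the brackets into scalar inequalities for mean
occupation probabilities. For `lam = c / d` and large `d` these are close to the map `x ↦ c *
exp(-x)`, whose fixed point is repelling when `c > e`, so the means stay apart. A zero-one law on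
infinite trees (`ae_notMem_of_infinite`) upgrades failure with positive probability to almost sure
failure. -/

namespace HardCore

/-- The graph `G` is a forest in which every vertex `v` has the finite set `ch v` of children,
and `level` is the depth of a vertex. -/
structure IsForest {V : Type*} (G : SimpleGraph V) (ch : V → Finset V) (level : V → ℕ) :
    Prop where
  adj : ∀ u v, G.Adj u v ↔ v ∈ ch u ∨ u ∈ ch v
  level_ch : ∀ u v, v ∈ ch u → level v = level u + 1
  parent_unique : ∀ u u' v, v ∈ ch u → v ∈ ch u' → u = u'

/-- The vacancy probabilities `x v` (in the subtree of `v`) of the hard-core model on the finite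
set `F` of vertices of a forest. -/
structure IsMessage {V : Type*} (ch : V → Finset V) (lam : ℝ) (F : Finset V) (x : V → ℝ) :
    Prop where
  off : ∀ v, v ∉ F → x v = 1
  on : ∀ v ∈ F, x v = 1 / (1 + lam * ∏ c ∈ ch v, x c)
  pos : ∀ v, 0 < x v
  le_one : ∀ v, x v ≤ 1

/-! ### The hard-core model on a forest as a Markov chain -/

section Markov

open scoped Classical

variable {V : Type*} {G : SimpleGraph V} {ch : V → Finset V} {level : V → ℕ}

/-- The probability of the state of `v` in the configuration `S`, given the state of its parent. -/
noncomputable def transition (ch : V → Finset V) (x : V → ℝ) (S : Finset V) (v : V) : ℝ :=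
  if ∃ u ∈ S, v ∈ ch u then (if v ∈ S then 0 else 1) else (if v ∈ S then 1 - x v else x v)

theorem exists_isMessage (hG : IsForest G ch level) {lam : ℝ} (hlam : 0 < lam) (F : Finset V) :
    ∃ x, IsMessage ch lam F x := by
  let step (y : V → ℝ) : V → ℝ := fun v => if v ∈ F then 1 / (1 + lam * ∏ c ∈ ch v, y c) else 1
  have hstep : ∀ k v, 0 < step^[k] (fun _ => 1) v ∧ step^[k] (fun _ => 1) v ≤ 1 := by
    intro k
    induction k with
    | zero => intro v; simp
    | succ k ih =>
      intro v
      rw [Function.iterate_succ_apply']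
      by_cases hv : v ∈ F
      · have hp : 0 ≤ lam * ∏ c ∈ ch v, step^[k] (fun _ => 1) c :=
          mul_nonneg hlam.le (Finset.prod_nonneg fun c _ => (ih c).1.le)
        simp only [step, hv, if_true]
        exact ⟨by positivity, by rw [div_le_one (by positivity)]; linarith⟩
      · simp [step, hv]
  obtain ⟨n, hn⟩ : ∃ n, ∀ v ∈ F, level v ≤ n :=
    ⟨F.sup level, fun v hv => Finset.le_sup (f := level) hv⟩
  -- The recursion only looks downwards and `F` has depth at most `n`, so `n + 1 - level v`
  -- iterations determine the value at `v`. Below depth `n` the truncated subtraction gives the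
  -- initial value 1, as it should off `F`.
  refine ⟨fun v => step^[n + 1 - level v] (fun _ => 1) v, ?_, ?_, fun v => (hstep _ v).1,
    fun v => (hstep _ v).2⟩
  · intro v hv
    cases h : n + 1 - level v with
    | zero => simp
    | succ k => simp only [Function.iterate_succ_apply', step, hv, if_false]
  · intro v hv
    have h : n + 1 - level v = (n - level v) + 1 := by have := hn v hv; omega
    simp only [h, Function.iterate_succ_apply']
    simp only [step, hv, if_true]
    congr 3
    refine Finset.prod_congr rfl fun c hc => ?_
    have := hG.level_ch v c hc
    rw [show n + 1 - level c = n - level v by omega]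

variable {lam : ℝ} {F T Λ : Finset V} {x : V → ℝ}

/-- An occupied `v` contributes `1 - x v = lam * x v * ∏ x c`. The product over its children makes
up for their factors, which are 1 because they are blocked. Up to a constant the chain therefore has
the hard-core weights. -/
theorem prod_transition (hG : IsForest G ch level) (hlam : 0 < lam) (hx : IsMessage ch lam F x)
    (hT : F ⊆ T) (hT' : ∀ v ∈ F, ch v ⊆ T) {S : Finset V} (hS : S ⊆ F)
    (hind : G.IsIndepSet (S : Set V)) :
    ∏ v ∈ T, transition ch x S v = lam ^ S.card * ∏ v ∈ T, x v := by
  have hd : Disjoint S (S.biUnion ch) := by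
    rw [Finset.disjoint_left]
    intro v hv hv'
    obtain ⟨u, hu, huv⟩ := Finset.mem_biUnion.1 hv'
    have hadj : G.Adj u v := (hG.adj u v).2 (Or.inl huv)
    exact hind hu hv hadj.ne hadj
  have hsub : S ∪ S.biUnion ch ⊆ T := by
    refine Finset.union_subset (hS.trans hT) ?_
    exact Finset.biUnion_subset.2 fun u hu => hT' u (hS hu)
  have hpd : (S : Set V).PairwiseDisjoint ch := by
    intro u _ u' _ hne
    rw [Function.onFun, Finset.disjoint_left]
    exact fun v h h' => hne (hG.parent_unique u u' v h h')
  rw [← Finset.prod_sdiff hsub, ← Finset.prod_sdiff hsub, Finset.prod_union hd,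
    Finset.prod_union hd, Finset.prod_biUnion hpd, Finset.prod_biUnion hpd]
  have h1 : ∏ v ∈ T \ (S ∪ S.biUnion ch), transition ch x S v =
      ∏ v ∈ T \ (S ∪ S.biUnion ch), x v := by
    refine Finset.prod_congr rfl fun v hv => ?_
    simp only [Finset.mem_sdiff, Finset.mem_union, Finset.mem_biUnion, not_or] at hv
    simp [transition, hv.2.1, hv.2.2]
  have h2 : ∏ v ∈ S, transition ch x S v = ∏ v ∈ S, (lam * (x v * ∏ c ∈ ch v, x c)) := by
    refine Finset.prod_congr rfl fun v hv => ?_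
    have hn : ¬ ∃ u ∈ S, v ∈ ch u := fun ⟨u, hu, h⟩ =>
      Finset.disjoint_left.1 hd hv (Finset.mem_biUnion.2 ⟨u, hu, h⟩)
    simp only [transition, hn, hv, if_true, if_false]
    have hp : 0 < ∏ c ∈ ch v, x c := Finset.prod_pos fun c _ => hx.pos c
    rw [hx.on v (hS hv)]
    field_simp
    ring
  have h3 : ∏ u ∈ S, ∏ v ∈ ch u, transition ch x S v = 1 := by
    refine Finset.prod_eq_one fun u hu => Finset.prod_eq_one fun v hv => ?_
    have hn : ∃ u ∈ S, v ∈ ch u := ⟨u, hu, hv⟩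
    have hv' : v ∉ S := fun h => Finset.disjoint_left.1 hd h (Finset.mem_biUnion.2 hn)
    simp only [transition, hn, hv', if_true, if_false]
  rw [h1, h2, h3, Finset.prod_mul_distrib, Finset.prod_mul_distrib, Finset.prod_const]
  ring

/-- An occupied child of an occupied vertex has factor 0. An occupied vertex outside `F` has message
1, so its factor is 0 whatever its parent does. -/
theorem prod_transition_eq_zero (hG : IsForest G ch level) (hx : IsMessage ch lam F x)
    {S : Finset V} (hST : S ⊆ T) (h : ¬ (S ⊆ F ∧ G.IsIndepSet (S : Set V))) :
    ∏ v ∈ T, transition ch x S v = 0 := by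
  suffices h' : ∃ v ∈ S, transition ch x S v = 0 by
    obtain ⟨v, hv, h0⟩ := h'
    exact Finset.prod_eq_zero (hST hv) h0
  by_cases hF : S ⊆ F
  · have hi : ¬ G.IsIndepSet (S : Set V) := fun hi => h ⟨hF, hi⟩
    simp only [SimpleGraph.IsIndepSet, Set.Pairwise, not_forall, not_not] at hi
    obtain ⟨u, hu, v, hv, _, hadj⟩ := hi
    rcases (hG.adj u v).1 hadj with h1 | h1
    · exact ⟨v, hv, by rw [transition, if_pos ⟨u, hu, h1⟩, if_pos (Finset.mem_coe.1 hv)]⟩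
    · exact ⟨u, hu, by rw [transition, if_pos ⟨v, hv, h1⟩, if_pos (Finset.mem_coe.1 hu)]⟩
  · obtain ⟨v, hv, hvF⟩ := Finset.not_subset.1 hF
    refine ⟨v, hv, ?_⟩
    simp only [transition, hv, if_true, hx.off v hvF, sub_self, ite_self]

/-- The vertices outside `Λ` are summed out from the deepest upwards: no vertex left in `T` is a
child of the removed one, and its two transition probabilities add up to 1. -/
theorem sum_prod_transition (hG : IsForest G ch level) (x : V → ℝ)
    (hΛ : ∀ u v, v ∈ Λ → v ∈ ch u → u ∈ Λ) {η : Finset V} (hη : η ⊆ Λ) :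
    ∀ T : Finset V, Λ ⊆ T →
    ∑ S ∈ T.powerset, (if S ∩ Λ = η then ∏ v ∈ T, transition ch x S v else 0) =
      ∏ v ∈ Λ, transition ch x η v := by
  intro T
  induction hn : (T \ Λ).card generalizing T with
  | zero =>
    intro hT
    have : T = Λ := (Finset.sdiff_eq_empty_iff_subset.1 (Finset.card_eq_zero.1 hn)).antisymm hT
    subst this
    rw [Finset.sum_eq_single η]
    · rw [if_pos (Finset.inter_eq_left.2 hη)]
    · intro S hS hne
      rw [if_neg]
      rwa [Finset.inter_eq_left.2 (Finset.mem_powerset.1 hS)]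
    · intro h
      exact absurd (Finset.mem_powerset.2 hη) h
  | succ n ih =>
    intro hT
    have hne : (T \ Λ).Nonempty := by rw [← Finset.card_pos]; omega
    obtain ⟨u, hu, hmax⟩ := Finset.exists_max_image (T \ Λ) level hne
    obtain ⟨huT, huΛ⟩ := Finset.mem_sdiff.1 hu
    have hT' : Λ ⊆ T.erase u := fun v hv =>
      Finset.mem_erase.2 ⟨fun h => huΛ (h ▸ hv), hT hv⟩
    have hcard : (T.erase u \ Λ).card = n := by
      rw [Finset.erase_sdiff_comm, Finset.card_erase_of_mem hu, hn]; rfl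
    rw [← ih (T.erase u) hcard hT']
    have hch : ∀ v ∈ T, v ∉ ch u := by
      intro v hv hvu
      by_cases hvΛ : v ∈ Λ
      · exact huΛ (hΛ u v hvΛ hvu)
      · have h1 := hmax v (Finset.mem_sdiff.2 ⟨hv, hvΛ⟩)
        have h2 := hG.level_ch u v hvu
        omega
    have hrest : ∀ S : Finset V, u ∉ S → ∀ v ∈ T.erase u,
        transition ch x (insert u S) v = transition ch x S v := by
      intro S _ v hv
      obtain ⟨hvu, hvT⟩ := Finset.mem_erase.1 hv
      have h1 : (∃ w ∈ insert u S, v ∈ ch w) ↔ ∃ w ∈ S, v ∈ ch w := by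
        constructor
        · rintro ⟨w, hw, hvw⟩
          rcases Finset.mem_insert.1 hw with rfl | hw
          · exact absurd hvw (hch v hvT)
          · exact ⟨w, hw, hvw⟩
        · rintro ⟨w, hw, hvw⟩
          exact ⟨w, Finset.mem_insert_of_mem hw, hvw⟩
      have h2 : v ∈ insert u S ↔ v ∈ S := by simp [hvu]
      simp only [transition, h1, h2]
    conv_lhs => rw [← Finset.insert_erase huT]
    rw [Finset.sum_powerset_insert (Finset.notMem_erase u T), ← Finset.sum_add_distrib]
    refine Finset.sum_congr rfl fun S hS => ?_
    have huS : u ∉ S := fun h => Finset.notMem_erase u T (Finset.mem_powerset.1 hS h)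
    rw [Finset.insert_inter_of_notMem huΛ]
    by_cases hSη : S ∩ Λ = η
    · simp only [hSη, if_true]
      rw [Finset.prod_insert (Finset.notMem_erase u T), Finset.prod_insert
        (Finset.notMem_erase u T), Finset.prod_congr rfl (hrest S huS), ← add_mul]
      have hself : (∃ w ∈ insert u S, u ∈ ch w) ↔ ∃ w ∈ S, u ∈ ch w := by
        constructor
        · rintro ⟨w, hw, hvw⟩
          rcases Finset.mem_insert.1 hw with rfl | hw
          · exact absurd hvw (hch w huT)
          · exact ⟨w, hw, hvw⟩
        · rintro ⟨w, hw, hvw⟩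
          exact ⟨w, Finset.mem_insert_of_mem hw, hvw⟩
      have : transition ch x S u + transition ch x (insert u S) u = 1 := by
        simp only [transition, hself, huS, Finset.mem_insert_self, if_true, if_false]
        split_ifs <;> ring
      rw [this, one_mul]
    · simp only [hSη, if_false, add_zero]

/-! ### Conditioning on a boundary condition, and total variation bounds -/

/-- The vertices of `Ψ` whose state is not determined by the boundary condition `σ` on `B`. -/
noncomputable def free (G : SimpleGraph V) (Ψ B σ : Finset V) : Finset V :=
  Ψ.filter (fun v => v ∉ B ∧ ∀ u ∈ σ, ¬ G.Adj u v)

theorem mem_free {Ψ B σ : Finset V} {v : V} :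
    v ∈ free G Ψ B σ ↔ v ∈ Ψ ∧ v ∉ B ∧ ∀ u ∈ σ, ¬ G.Adj u v := by
  simp [free]

theorem union_mem_configs {Ψ B σ S : Finset V} (hσ : IsBoundaryCondition G B σ) (hB : B ⊆ Ψ)
    (hS : S ⊆ free G Ψ B σ) (hind : G.IsIndepSet (S : Set V)) : S ∪ σ ∈ configs G Ψ B σ := by
  have hSB : ∀ v ∈ S, v ∉ B := fun v hv => (mem_free.1 (hS hv)).2.1
  simp only [configs, Finset.mem_filter, Finset.mem_powerset]
  refine ⟨Finset.union_subset (fun v hv => (mem_free.1 (hS hv)).1) (hσ.1.trans hB), ?_, ?_⟩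
  · intro u hu v hv hne hadj
    simp only [Finset.coe_union, Set.mem_union, Finset.mem_coe] at hu hv
    rcases hu with hu | hu <;> rcases hv with hv | hv
    · exact hind hu hv hne hadj
    · exact (mem_free.1 (hS hu)).2.2 v hv hadj.symm
    · exact (mem_free.1 (hS hv)).2.2 u hu hadj
    · exact hσ.2 hu hv hne hadj
  · ext v
    simp only [Finset.mem_inter, Finset.mem_union]
    exact ⟨fun ⟨h, hvB⟩ => h.resolve_left fun h => hSB v h hvB, fun h => ⟨Or.inr h, hσ.1 h⟩⟩

/-- The admissible configurations are the disjoint unions of `σ` with independent sets of free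
vertices, so conditioning only shrinks the vertex set and adds a constant factor. A frozen vertex
may carry the neutral message 1 even if it is occupied, since its neighbours are then not free. -/
theorem sum_configs {Ψ B σ : Finset V} (hσ : IsBoundaryCondition G B σ) (hB : B ⊆ Ψ)
    (p : Finset V → Prop) [DecidablePred p] :
    ∑ S ∈ (configs G Ψ B σ).filter p, lam ^ S.card =
      lam ^ σ.card * ∑ S ∈ (free G Ψ B σ).powerset,
        (if G.IsIndepSet (S : Set V) ∧ p (S ∪ σ) then lam ^ S.card else 0) := by
  rw [← Finset.sum_filter, Finset.mul_sum]
  symm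
  refine Finset.sum_nbij' (fun S => S ∪ σ) (fun S => S \ σ) ?_ ?_ ?_ ?_ ?_
  · intro S hS
    simp only [Finset.mem_filter, Finset.mem_powerset] at hS
    exact Finset.mem_filter.2 ⟨union_mem_configs hσ hB hS.1 hS.2.1, hS.2.2⟩
  · intro S hS
    simp only [configs, Finset.mem_filter, Finset.mem_powerset] at hS ⊢
    obtain ⟨⟨hSΨ, hind, hSB⟩, hp⟩ := hS
    have hσS : σ ⊆ S := by rw [← hSB]; exact Finset.inter_subset_left
    refine ⟨fun v hv => ?_, ?_, ?_⟩
    · obtain ⟨hvS, hvσ⟩ := Finset.mem_sdiff.1 hv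
      refine mem_free.2 ⟨hSΨ hvS, fun hvB => hvσ ?_, fun u hu hadj => ?_⟩
      · rw [← hSB]; exact Finset.mem_inter.2 ⟨hvS, hvB⟩
      · exact hind (hσS hu) hvS hadj.ne hadj
    · exact hind.mono (by simp)
    · rwa [Finset.sdiff_union_of_subset hσS]
  · intro S hS
    simp only [Finset.mem_filter, Finset.mem_powerset] at hS
    have hd : Disjoint S σ := by
      rw [Finset.disjoint_left]
      exact fun v hv hvσ => (mem_free.1 (hS.1 hv)).2.1 (hσ.1 hvσ)
    exact Finset.union_sdiff_cancel_right hd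
  · intro S hS
    simp only [configs, Finset.mem_filter, Finset.mem_powerset] at hS
    obtain ⟨⟨hSΨ, hind, hSB⟩, hp⟩ := hS
    have hσS : σ ⊆ S := by rw [← hSB]; exact Finset.inter_subset_left
    exact Finset.sdiff_union_of_subset hσS
  · intro S hS
    simp only [Finset.mem_filter, Finset.mem_powerset] at hS
    have hd : Disjoint S σ := by
      rw [Finset.disjoint_left]
      exact fun v hv hvσ => (mem_free.1 (hS.1 hv)).2.1 (hσ.1 hvσ)
    rw [Finset.card_union_of_disjoint hd, pow_add, mul_comm]

/-- The partition function restricted to configurations with prescribed trace on an ancestor-closed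
set is a product of transition probabilities. -/
theorem sum_indep_eq (hG : IsForest G ch level) (hlam : 0 < lam) (hx : IsMessage ch lam F x)
    (hT : F ⊆ T) (hT' : ∀ v ∈ F, ch v ⊆ T) (hΛT : Λ ⊆ T)
    (hΛ : ∀ u v, v ∈ Λ → v ∈ ch u → u ∈ Λ) {η : Finset V} (hη : η ⊆ Λ) :
    (∑ S ∈ F.powerset, (if G.IsIndepSet (S : Set V) ∧ S ∩ Λ = η then lam ^ S.card else 0)) *
      ∏ v ∈ T, x v = ∏ v ∈ Λ, transition ch x η v := by
  rw [← sum_prod_transition hG x hΛ hη T hΛT, Finset.sum_mul]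
  refine Finset.sum_subset_zero_on_sdiff (Finset.powerset_mono.2 hT) ?_ ?_
  · intro S hS
    simp only [Finset.mem_sdiff, Finset.mem_powerset] at hS
    rw [prod_transition_eq_zero hG hx hS.1 (fun h => hS.2 h.1), ite_self]
  · intro S hS
    rw [Finset.mem_powerset] at hS
    by_cases hi : G.IsIndepSet (S : Set V)
    · by_cases hp : S ∩ Λ = η
      · simp only [hi, hp, and_self, if_true]
        exact (prod_transition hG hlam hx hT hT' hS hi).symm
      · simp [hp]
    · simp only [hi, false_and, if_false, zero_mul]
      rw [prod_transition_eq_zero hG hx (hS.trans hT) (fun h => hi h.2), ite_self]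

theorem marginal_eq (hG : IsForest G ch level) (hlam : 0 < lam) {Ψ B σ : Finset V}
    (hσ : IsBoundaryCondition G B σ) (hB : B ⊆ Ψ) (hx : IsMessage ch lam (free G Ψ B σ) x)
    {Λ' : Finset V} (hΛ' : ∀ u v, v ∈ Λ' → v ∈ ch u → u ∈ Λ') (hΛ : Λ ⊆ Λ') (η : Finset V) :
    marginal G lam Ψ B σ Λ η =
      ∑ ζ ∈ Λ'.powerset with (ζ ∪ σ) ∩ Λ = η, ∏ v ∈ Λ', transition ch x ζ v := by
  set F := free G Ψ B σ with hF
  set T := F ∪ F.biUnion ch ∪ Λ' with hTdef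
  have hT : F ⊆ T := fun v hv => by simp [hTdef, hv]
  have hT' : ∀ v ∈ F, ch v ⊆ T := fun v hv c hc => by
    simp only [hTdef, Finset.mem_union, Finset.mem_biUnion]
    exact Or.inl (Or.inr ⟨v, hv, hc⟩)
  have hΛT : Λ' ⊆ T := fun v hv => by simp [hTdef, hv]
  have hX : 0 < ∏ v ∈ T, x v := Finset.prod_pos fun v _ => hx.pos v
  have hZ : partitionFunction G lam Ψ B σ * ∏ v ∈ T, x v = lam ^ σ.card := by
    have h1 := sum_configs (lam := lam) hσ hB (fun _ => True)
    -- With empty `Λ` nothing is prescribed, and the identity computes the normalising constant.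
    have h2 := sum_indep_eq (Λ := ∅) hG hlam hx hT hT' (Finset.empty_subset _) (by simp)
      (Finset.empty_subset ∅)
    simp only [Finset.inter_empty, Finset.prod_empty] at h2
    simp only [Finset.filter_true] at h1
    rw [partitionFunction, h1, mul_assoc]
    simp only [and_true] at h2 ⊢
    rw [h2, mul_one]
  have hN : (∑ S ∈ (configs G Ψ B σ).filter (fun S => S ∩ Λ = η), lam ^ S.card) * ∏ v ∈ T, x v =
      lam ^ σ.card *
        ∑ ζ ∈ Λ'.powerset with (ζ ∪ σ) ∩ Λ = η, ∏ v ∈ Λ', transition ch x ζ v := by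
    rw [sum_configs hσ hB, mul_assoc]
    congr 1
    rw [Finset.sum_congr rfl fun ζ hζ => (sum_indep_eq hG hlam hx hT hT' hΛT hΛ'
      (Finset.mem_powerset.1 (Finset.mem_filter.1 hζ).1)).symm, ← Finset.sum_mul,
      Finset.sum_comm]
    congr 1
    refine Finset.sum_congr rfl fun S _ => ?_
    have key : (S ∪ σ) ∩ Λ = (S ∩ Λ' ∪ σ) ∩ Λ := by
      ext v
      simp only [Finset.mem_inter, Finset.mem_union]
      exact ⟨fun ⟨h, h'⟩ => ⟨h.imp (fun h => ⟨h, hΛ h'⟩) id, h'⟩,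
        fun ⟨h, h'⟩ => ⟨h.imp (fun h => h.1) id, h'⟩⟩
    rw [Finset.sum_filter, Finset.sum_eq_single (S ∩ Λ')]
    · rw [← key]
      by_cases h1 : G.IsIndepSet (S : Set V) <;> by_cases h2 : (S ∪ σ) ∩ Λ = η <;> simp [h1, h2]
    · intro ζ _ hne
      simp [Ne.symm hne]
    · intro h
      exact absurd (Finset.mem_powerset.2 Finset.inter_subset_right) h
  have hl : lam ^ σ.card ≠ 0 := (pow_pos hlam _).ne'
  have hZ0 : partitionFunction G lam Ψ B σ ≠ 0 := by
    intro h
    rw [h, zero_mul] at hZ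
    exact hl hZ.symm
  rw [marginal, div_eq_iff hZ0]
  refine mul_right_cancel₀ hX.ne' ?_
  rw [hN, mul_assoc, hZ, mul_comm]

theorem abs_prod_transition_sub_le {y : V → ℝ} (hx : ∀ v, 0 < x v ∧ x v ≤ 1)
    (hy : ∀ v, 0 < y v ∧ y v ≤ 1) (S Λ : Finset V) :
    |∏ v ∈ Λ, transition ch x S v - ∏ v ∈ Λ, transition ch y S v| ≤ ∑ v ∈ Λ, |x v - y v| := by
  have hb : ∀ z : V → ℝ, (∀ v, 0 < z v ∧ z v ≤ 1) → ∀ v, |transition ch z S v| ≤ 1 := by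
    intro z hz v
    have := hz v
    unfold transition
    split_ifs <;> rw [abs_le] <;> constructor <;> linarith
  have hd : ∀ v, |transition ch x S v - transition ch y S v| ≤ |x v - y v| := by
    intro v
    unfold transition
    split_ifs
    · simp
    · simp
    · rw [sub_sub_sub_cancel_left, abs_sub_comm]
    · exact le_rfl
  induction Λ using Finset.induction_on with
  | empty => simp
  | insert u Λ hu ih =>
    rw [Finset.prod_insert hu, Finset.prod_insert hu, Finset.sum_insert hu]
    have hP : |∏ v ∈ Λ, transition ch y S v| ≤ 1 := by
      rw [Finset.abs_prod]
      exact Finset.prod_le_one (fun _ _ => abs_nonneg _) fun v _ => hb y hy v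
    calc |transition ch x S u * ∏ v ∈ Λ, transition ch x S v -
          transition ch y S u * ∏ v ∈ Λ, transition ch y S v|
        = |(transition ch x S u - transition ch y S u) * ∏ v ∈ Λ, transition ch y S v +
          transition ch x S u * (∏ v ∈ Λ, transition ch x S v -
            ∏ v ∈ Λ, transition ch y S v)| := by congr 1; ring
      _ ≤ |x u - y u| * 1 + 1 * ∑ v ∈ Λ, |x v - y v| := by
        refine (abs_add_le _ _).trans ?_
        rw [abs_mul, abs_mul]
        exact add_le_add (mul_le_mul (hd u) hP (abs_nonneg _) (abs_nonneg _))
          (mul_le_mul (hb x hx u) ih (abs_nonneg _) zero_le_one)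
      _ = _ := by ring

/-- The total variation distance is controlled by the differences of messages on an ancestor-closed
set. -/
theorem tvDist_le (hG : IsForest G ch level) (hlam : 0 < lam) {Ψ B σ τ : Finset V}
    (hσ : IsBoundaryCondition G B σ) (hτ : IsBoundaryCondition G B τ) (hB : B ⊆ Ψ)
    (hστ : σ ∩ Λ = τ ∩ Λ) {y : V → ℝ}
    (hx : IsMessage ch lam (free G Ψ B σ) x) (hy : IsMessage ch lam (free G Ψ B τ) y)
    {Λ' : Finset V} (hΛ' : ∀ u v, v ∈ Λ' → v ∈ ch u → u ∈ Λ') (hΛ : Λ ⊆ Λ') :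
    tvDist G lam Ψ B σ τ Λ ≤ 2 ^ Λ.card * 2 ^ Λ'.card * ∑ v ∈ Λ', |x v - y v| := by
  set D := ∑ v ∈ Λ', |x v - y v| with hD
  have hD0 : 0 ≤ D := Finset.sum_nonneg fun _ _ => abs_nonneg _
  have h1 : ∀ η, |marginal G lam Ψ B σ Λ η - marginal G lam Ψ B τ Λ η| ≤ 2 ^ Λ'.card * D := by
    intro η
    have hc : ∀ ζ : Finset V, (ζ ∪ σ) ∩ Λ = (ζ ∪ τ) ∩ Λ := by
      intro ζ
      rw [Finset.union_inter_distrib_right, Finset.union_inter_distrib_right, hστ]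
    rw [marginal_eq hG hlam hσ hB hx hΛ' hΛ, marginal_eq hG hlam hτ hB hy hΛ' hΛ]
    simp only [hc]
    rw [← Finset.sum_sub_distrib]
    refine (Finset.abs_sum_le_sum_abs _ _).trans ((Finset.sum_le_card_nsmul _ _ D fun ζ _ =>
      abs_prod_transition_sub_le (fun v => ⟨hx.pos v, hx.le_one v⟩)
        (fun v => ⟨hy.pos v, hy.le_one v⟩) ζ Λ').trans ?_)
    rw [nsmul_eq_mul]
    refine mul_le_mul_of_nonneg_right ?_ hD0
    have := Finset.card_filter_le Λ'.powerset (fun ζ => (ζ ∪ τ) ∩ Λ = η)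
    rw [Finset.card_powerset] at this
    exact_mod_cast this
  have h2 : ∑ η ∈ Λ.powerset, |marginal G lam Ψ B σ Λ η - marginal G lam Ψ B τ Λ η| ≤
      2 ^ Λ.card * (2 ^ Λ'.card * D) := by
    refine (Finset.sum_le_card_nsmul _ _ _ fun η _ => h1 η).trans_eq ?_
    rw [nsmul_eq_mul, Finset.card_powerset]
    push_cast
    rfl
  have h3 : 0 ≤ (2 : ℝ) ^ Λ.card * (2 ^ Λ'.card * D) := by positivity
  rw [tvDist, mul_assoc]
  linarith

/-- At a root that is not frozen, the occupation probability is `1 - x r`. One term of the total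
variation sum already sees the difference. -/
theorem le_tvDist_singleton (hG : IsForest G ch level) (hlam : 0 < lam) {Ψ B σ τ : Finset V}
    (hσ : IsBoundaryCondition G B σ) (hτ : IsBoundaryCondition G B τ) (hB : B ⊆ Ψ) {y : V → ℝ}
    (hx : IsMessage ch lam (free G Ψ B σ) x) (hy : IsMessage ch lam (free G Ψ B τ) y)
    {r : V} (hr : ∀ u, r ∉ ch u) (hrB : r ∉ B) :
    1 / 2 * |x r - y r| ≤ tvDist G lam Ψ B σ τ {r} := by
  have hcl : ∀ u v, v ∈ ({r} : Finset V) → v ∈ ch u → u ∈ ({r} : Finset V) := by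
    intro u v hv hvu
    rw [Finset.mem_singleton.1 hv] at hvu
    exact absurd hvu (hr u)
  have key : ∀ ρ : Finset V, ∀ z : V → ℝ, IsBoundaryCondition G B ρ →
      IsMessage ch lam (free G Ψ B ρ) z → marginal G lam Ψ B ρ {r} {r} = 1 - z r := by
    intro ρ z hρ hz
    rw [marginal_eq hG hlam hρ hB hz hcl (Finset.Subset.refl _)]
    have hrρ : r ∉ ρ := fun h => hrB (hρ.1 h)
    have : ({ζ ∈ ({r} : Finset V).powerset | (ζ ∪ ρ) ∩ {r} = {r}} : Finset (Finset V)) =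
        {{r}} := by
      ext ζ
      simp only [Finset.mem_filter, Finset.mem_powerset, Finset.subset_singleton_iff,
        Finset.mem_singleton, Finset.inter_eq_right, Finset.singleton_subset_iff,
        Finset.mem_union, hrρ, or_false]
      constructor
      · rintro ⟨rfl | rfl, h⟩
        · simp at h
        · rfl
      · rintro rfl
        simp
    rw [this, Finset.sum_singleton, Finset.prod_singleton]
    simp [transition, hr]
  rw [tvDist]
  refine mul_le_mul_of_nonneg_left ?_ (by norm_num)
  refine le_trans (le_of_eq ?_) (Finset.single_le_sum
    (f := fun η => |marginal G lam Ψ B σ {r} η - marginal G lam Ψ B τ {r} η|)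
    (fun _ _ => abs_nonneg _) (Finset.mem_powerset_self {r}))
  rw [key σ x hσ hx, key τ y hτ hy, sub_sub_sub_cancel_left, abs_sub_comm]

end Markov

end HardCore

/-! ### The coded tree as a forest: subtrees, depth, distance -/

namespace PoissonTree

/-- The offspring counts of the subtree hanging below the label `v`. -/
def shift (v : List ℕ) (N : List ℕ → ℕ) : List ℕ → ℕ := fun w => N (w ++ v)

theorem shift_nil (N : List ℕ → ℕ) : shift [] N = N := by
  funext w; simp [shift]

theorem shift_apply_nil (v : List ℕ) (N : List ℕ → ℕ) : shift v N [] = N v := by simp [shift]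

theorem shift_singleton_shift (i : ℕ) (v : List ℕ) (N : List ℕ → ℕ) :
    shift [i] (shift v N) = shift (i :: v) N := by
  funext w; simp [shift]

/-- The vertices of the tree with offspring counts `N`. -/
abbrev Vertex (N : List ℕ → ℕ) : Type := {v : List ℕ // IsVertex N v}

/-- The root. -/
def root (N : List ℕ → ℕ) : Vertex N := ⟨[], trivial⟩

/-- The depth of a vertex. -/
def level {N : List ℕ → ℕ} (v : Vertex N) : ℕ := v.1.length

/-- The children of a vertex. -/
def children {N : List ℕ → ℕ} (v : Vertex N) : Finset (Vertex N) :=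
  Finset.univ.map ⟨fun i : Fin (N v.1) => (⟨i.1 :: v.1, v.2, i.2⟩ : Vertex N), fun _ _ h =>
    Fin.ext (List.cons.inj (congrArg Subtype.val h)).1⟩

variable {N : List ℕ → ℕ}

theorem mem_children {u v : Vertex N} : v ∈ children u ↔ ∃ i, v.1 = i :: u.1 := by
  simp only [children, Finset.mem_map, Finset.mem_univ, true_and]
  constructor
  · rintro ⟨i, rfl⟩
    exact ⟨i, rfl⟩
  · rintro ⟨i, hi⟩
    have h := v.2
    rw [hi] at h
    exact ⟨⟨i, h.2⟩, Subtype.ext hi.symm⟩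

@[to_additive]
theorem prod_children {M : Type*} [CommMonoid M] (f : List ℕ → M) (v : Vertex N) :
    ∏ c ∈ children v, f c.1 = ∏ i ∈ Finset.range (N v.1), f (i :: v.1) := by
  rw [children, Finset.prod_map, Finset.prod_range]
  rfl

theorem isForest (N : List ℕ → ℕ) : HardCore.IsForest (graph N) children level where
  adj u v := by rw [mem_children, mem_children]; rfl
  level_ch u v h := by
    obtain ⟨i, hi⟩ := mem_children.1 h
    simp [level, hi]
  parent_unique u u' v h h' := by
    obtain ⟨i, hi⟩ := mem_children.1 h
    obtain ⟨j, hj⟩ := mem_children.1 h'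
    rw [hi] at hj
    exact Subtype.ext (List.cons.inj hj).2

theorem level_adj {u v : Vertex N} (h : (graph N).Adj u v) :
    level u ≤ level v + 1 ∧ level v ≤ level u + 1 ∧ level u ≠ level v := by
  rcases ((isForest N).adj u v).1 h with h | h <;> have := (isForest N).level_ch _ _ h <;> omega

theorem root_notMem_children (u : Vertex N) : root N ∉ children u := by
  intro h
  obtain ⟨i, hi⟩ := mem_children.1 h
  exact absurd hi (List.cons_ne_nil i u.1).symm

theorem exists_parent (v : Vertex N) (hv : 0 < level v) :
    ∃ u, v ∈ children u ∧ level v = level u + 1 := by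
  obtain ⟨l, hl⟩ := v
  cases l with
  | nil => simp [level] at hv
  | cons i u => exact ⟨⟨u, hl.1⟩, mem_children.2 ⟨i, rfl⟩, by simp [level]⟩

theorem eq_root_of_level {v : Vertex N} (h : level v = 0) : v = root N :=
  Subtype.ext (List.length_eq_zero_iff.1 h)

theorem finite_level_le (n : ℕ) : {v : Vertex N | level v ≤ n}.Finite := by
  induction n with
  | zero =>
    refine (Set.finite_singleton (root N)).subset fun v hv => ?_
    exact eq_root_of_level (Nat.le_zero.1 hv)
  | succ n ih =>
    refine (ih.union (ih.biUnion fun u _ => (children u).finite_toSet)).subset fun v hv => ?_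
    by_cases h : level v ≤ n
    · exact Or.inl h
    · obtain ⟨u, hu, hl⟩ := exists_parent v (by omega)
      refine Or.inr (Set.mem_biUnion (x := u) ?_ hu)
      have : level v ≤ n + 1 := hv
      simp only [Set.mem_ofPred_eq]
      omega

/-- The vertices of depth at most `n`. -/
noncomputable def ball (N : List ℕ → ℕ) (n : ℕ) : Finset (Vertex N) :=
  (finite_level_le (N := N) n).toFinset

theorem mem_ball {n : ℕ} {v : Vertex N} : v ∈ ball N n ↔ level v ≤ n := by simp [ball]

theorem ball_parent_closed (n : ℕ) (u v : Vertex N) (hv : v ∈ ball N n) (h : v ∈ children u) :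
    u ∈ ball N n := by
  have := (isForest N).level_ch u v h
  rw [mem_ball] at hv ⊢
  omega

theorem edist_root_le (v : Vertex N) : (graph N).edist (root N) v ≤ level v := by
  induction hn : level v generalizing v with
  | zero => rw [eq_root_of_level hn]; simp
  | succ n ih =>
    obtain ⟨u, hu, hl⟩ := exists_parent v (by omega)
    have hadj : (graph N).Adj u v := ((isForest N).adj u v).2 (Or.inl hu)
    refine (SimpleGraph.edist_triangle (v := u)).trans ?_
    rw [SimpleGraph.edist_eq_one_iff_adj.2 hadj]
    have := ih u (by omega)
    push_cast
    gcongr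

theorem edist_le_add (u v : Vertex N) : (graph N).edist u v ≤ ((level u + level v : ℕ) : ℕ∞) := by
  refine (SimpleGraph.edist_triangle (v := root N)).trans ?_
  rw [SimpleGraph.edist_comm]
  push_cast
  exact add_le_add (edist_root_le u) (edist_root_le v)

theorem level_le_edist (v : Vertex N) : (level v : ℕ∞) ≤ (graph N).edist (root N) v := by
  refine le_iInf fun p => ?_
  have : ∀ (u v : Vertex N) (p : (graph N).Walk u v), level v ≤ level u + p.length := by
    intro u v p
    induction p with
    | nil => simp
    | cons h p ih =>
      have := level_adj h
      simp only [SimpleGraph.Walk.length_cons]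
      omega
  have h := this _ _ p
  have h0 : level (root N) = 0 := rfl
  rw [h0, zero_add] at h
  exact_mod_cast h

theorem le_level_of_le_setDist {R r : ℕ} {Λ C : Finset (Vertex N)}
    (h : (R : ℕ∞) ≤ HardCore.setDist (graph N) Λ C) {u : Vertex N} (hu : u ∈ Λ)
    (hur : level u ≤ r) {w : Vertex N} (hw : w ∈ C) : R ≤ r + level w := by
  have h1 : HardCore.setDist (graph N) Λ C ≤ (graph N).edist u w :=
    (iInf₂_le u hu).trans (iInf₂_le w hw)
  have h2 := (h.trans h1).trans (edist_le_add u w)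
  have h3 : R ≤ level u + level w := by exact_mod_cast h2
  omega

/-! ### Bracketing the messages -/

/-- The iterates of the hard-core recursion, started from the constants `1` (for `true`)
and `0` (for `false`) at depth `k`; the roles alternate, so that the iterates bracket the vacancy
probability of the root. -/
noncomputable def bracket (lam : ℝ) : Bool → ℕ → (List ℕ → ℕ) → ℝ
  | b, 0, _ => if b then 1 else 0
  | b, k + 1, N => 1 / (1 + lam * ∏ i ∈ Finset.range (N []), bracket lam (!b) k (shift [i] N))

theorem one_div_one_add_anti {lam s t : ℝ} (hlam : 0 < lam) (hs : 0 ≤ s) (hst : s ≤ t) :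
    1 / (1 + lam * t) ≤ 1 / (1 + lam * s) := by
  have : lam * s ≤ lam * t := mul_le_mul_of_nonneg_left hst hlam.le
  have : 0 ≤ lam * s := by positivity
  exact one_div_le_one_div_of_le (by linarith) (by linarith)

variable {lam : ℝ}

theorem bracket_mem (hlam : 0 < lam) (b : Bool) (k : ℕ) (N : List ℕ → ℕ) :
    0 ≤ bracket lam b k N ∧ bracket lam b k N ≤ 1 := by
  induction k generalizing b N with
  | zero => cases b <;> simp [bracket]
  | succ k ih =>
    have hp : 0 ≤ lam * ∏ i ∈ Finset.range (N []), bracket lam (!b) k (shift [i] N) :=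
      mul_nonneg hlam.le (Finset.prod_nonneg fun i _ => (ih _ _).1)
    rw [bracket]
    exact ⟨by positivity, by rw [div_le_one (by positivity)]; linarith⟩

theorem bracket_mono (hlam : 0 < lam) (k : ℕ) (N : List ℕ → ℕ) :
    bracket lam false k N ≤ bracket lam false (k + 1) N ∧
      bracket lam true (k + 1) N ≤ bracket lam true k N := by
  induction k generalizing N with
  | zero =>
    constructor
    · rw [bracket]; simpa using (bracket_mem hlam false 1 N).1
    · conv_rhs => rw [bracket]
      simpa using (bracket_mem hlam true 1 N).2
  | succ k ih =>
    constructor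
    · rw [bracket, bracket]
      exact one_div_one_add_anti hlam (Finset.prod_nonneg fun i _ => (bracket_mem hlam _ _ _).1)
        (Finset.prod_le_prod (fun i _ => (bracket_mem hlam _ _ _).1) fun i _ => (ih _).2)
    · rw [bracket, bracket]
      exact one_div_one_add_anti hlam (Finset.prod_nonneg fun i _ => (bracket_mem hlam _ _ _).1)
        (Finset.prod_le_prod (fun i _ => (bracket_mem hlam _ _ _).1) fun i _ => (ih _).1)

theorem bracket_le (hlam : 0 < lam) (k : ℕ) (N : List ℕ → ℕ) :
    bracket lam false k N ≤ bracket lam true k N := by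
  induction k generalizing N with
  | zero => simp [bracket]
  | succ k ih =>
    rw [bracket, bracket]
    exact one_div_one_add_anti hlam (Finset.prod_nonneg fun i _ => (bracket_mem hlam _ _ _).1)
        (Finset.prod_le_prod (fun i _ => (bracket_mem hlam _ _ _).1) fun i _ => ih _)

/-- The limits of the upper (`true`) and lower (`false`) bracketing iterates. -/
noncomputable def bracketLim (lam : ℝ) (b : Bool) (N : List ℕ → ℕ) : ℝ :=
  if b then ⨅ k, bracket lam true k N else ⨆ k, bracket lam false k N

open Filter Topology in
theorem tendsto_bracket (hlam : 0 < lam) (b : Bool) (N : List ℕ → ℕ) :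
    Tendsto (fun k => bracket lam b k N) atTop (𝓝 (bracketLim lam b N)) := by
  cases b with
  | true =>
    simp only [bracketLim, if_true]
    exact tendsto_atTop_ciInf (antitone_nat_of_succ_le fun k => (bracket_mono hlam k N).2)
      ⟨0, by rintro _ ⟨k, rfl⟩; exact (bracket_mem hlam _ _ _).1⟩
  | false =>
    simp only [bracketLim, Bool.false_eq_true, if_false]
    exact tendsto_atTop_ciSup (monotone_nat_of_le_succ fun k => (bracket_mono hlam k N).1)
      ⟨1, by rintro _ ⟨k, rfl⟩; exact (bracket_mem hlam _ _ _).2⟩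

theorem bracketLim_mem (hlam : 0 < lam) (b : Bool) (N : List ℕ → ℕ) :
    0 ≤ bracketLim lam b N ∧ bracketLim lam b N ≤ 1 :=
  ⟨ge_of_tendsto' (tendsto_bracket hlam b N) fun k => (bracket_mem hlam b k N).1,
    le_of_tendsto' (tendsto_bracket hlam b N) fun k => (bracket_mem hlam b k N).2⟩

theorem bracketLim_le (hlam : 0 < lam) (N : List ℕ → ℕ) :
    bracketLim lam false N ≤ bracketLim lam true N :=
  le_of_tendsto_of_tendsto' (tendsto_bracket hlam false N) (tendsto_bracket hlam true N)
    fun k => bracket_le hlam k N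

theorem bracketLim_eq (hlam : 0 < lam) (b : Bool) (N : List ℕ → ℕ) :
    bracketLim lam b N =
      1 / (1 + lam * ∏ i ∈ Finset.range (N []), bracketLim lam (!b) (shift [i] N)) := by
  have hp : 0 ≤ lam * ∏ i ∈ Finset.range (N []), bracketLim lam (!b) (shift [i] N) :=
    mul_nonneg hlam.le (Finset.prod_nonneg fun i _ => (bracketLim_mem hlam _ _).1)
  refine tendsto_nhds_unique ((Filter.tendsto_add_atTop_iff_nat 1).2 (tendsto_bracket hlam b N)) ?_
  simp only [bracket]
  exact tendsto_const_nhds.div (((tendsto_finsetProd _ fun i _ =>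
    tendsto_bracket hlam (!b) (shift [i] N)).const_mul lam).const_add 1) (by positivity)

theorem bracketLim_pos (hlam : 0 < lam) (b : Bool) (N : List ℕ → ℕ) : 0 < bracketLim lam b N := by
  rw [bracketLim_eq hlam]
  have : 0 ≤ lam * ∏ i ∈ Finset.range (N []), bracketLim lam (!b) (shift [i] N) :=
    mul_nonneg hlam.le (Finset.prod_nonneg fun i _ => (bracketLim_mem hlam _ _).1)
  positivity

/-- The bracketing iterates at the root have a common limit. -/
def Tight (lam : ℝ) (N : List ℕ → ℕ) : Prop := bracketLim lam false N = bracketLim lam true N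

/-- All limits are positive, so the product over the children is strictly monotone in each factor,
and a gap at a single child opens a gap at the root. The equivalence passes tightness down to
subtrees and makes it an event to which the zero-one law applies. -/
theorem tight_iff (hlam : 0 < lam) (N : List ℕ → ℕ) :
    Tight lam N ↔ ∀ i < N [], Tight lam (shift [i] N) := by
  constructor
  · intro h i hi
    by_contra hne
    have hlt := lt_of_le_of_ne (bracketLim_le hlam (shift [i] N)) hne
    have hprod : ∏ i ∈ Finset.range (N []), bracketLim lam false (shift [i] N) <
        ∏ i ∈ Finset.range (N []), bracketLim lam true (shift [i] N) :=
      Finset.prod_lt_prod (fun j _ => bracketLim_pos hlam _ _)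
        (fun j _ => bracketLim_le hlam _) ⟨i, Finset.mem_range.2 hi, hlt⟩
    have h0 : 0 ≤ ∏ i ∈ Finset.range (N []), bracketLim lam false (shift [i] N) :=
      Finset.prod_nonneg fun i _ => (bracketLim_mem hlam _ _).1
    rw [Tight, bracketLim_eq hlam, bracketLim_eq hlam true] at h
    simp only [Bool.not_false, Bool.not_true] at h
    have h1 := mul_lt_mul_of_pos_left hprod hlam
    have h2 : 0 ≤ lam * ∏ i ∈ Finset.range (N []), bracketLim lam false (shift [i] N) := by
      positivity
    have := one_div_lt_one_div_of_lt (by linarith) (add_lt_add_right h1 1)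
    linarith
  · intro h
    rw [Tight, bracketLim_eq hlam, bracketLim_eq hlam true]
    simp only [Bool.not_false, Bool.not_true]
    rw [Finset.prod_congr rfl fun i hi => (h i (Finset.mem_range.1 hi)).symm]

theorem Tight.shift (hlam : 0 < lam) (h : Tight lam N) (v : Vertex N) :
    Tight lam (shift v.1 N) := by
  obtain ⟨l, hl⟩ := v
  induction l with
  | nil => rwa [shift_nil]
  | cons i u ih =>
    rw [← shift_singleton_shift]
    exact (tight_iff hlam _).1 (ih hl.1) i (by rw [shift_apply_nil]; exact hl.2)

theorem bracket_shift_succ (b : Bool) (k : ℕ) (v : Vertex N) :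
    bracket lam b (k + 1) (shift v.1 N) =
      1 / (1 + lam * ∏ c ∈ children v, bracket lam (!b) k (shift c.1 N)) := by
  rw [bracket, shift_apply_nil, prod_children (fun l => bracket lam (!b) k (shift l N))]
  simp only [shift_singleton_shift]

theorem bracketLim_shift (hlam : 0 < lam) (b : Bool) (v : Vertex N) :
    bracketLim lam b (shift v.1 N) =
      1 / (1 + lam * ∏ c ∈ children v, bracketLim lam (!b) (shift c.1 N)) := by
  rw [bracketLim_eq hlam, shift_apply_nil, prod_children (fun l => bracketLim lam (!b) (shift l N))]
  simp only [shift_singleton_shift]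

/-! ### Weak spatial mixing and tightness of the brackets -/

theorem bracket_message (hlam : 0 < lam) {F : Finset (Vertex N)} {x : Vertex N → ℝ} {m : ℕ}
    (hx : HardCore.IsMessage children lam F x) (hF : ∀ v : Vertex N, level v < m → v ∈ F) (k : ℕ)
    (v : Vertex N) (hv : level v + k ≤ m) :
    bracket lam false k (shift v.1 N) ≤ x v ∧ x v ≤ bracket lam true k (shift v.1 N) := by
  induction k generalizing v with
  | zero => simpa [bracket] using ⟨(hx.pos v).le, hx.le_one v⟩
  | succ k ih =>
    have hc : ∀ c ∈ children v, level c + k ≤ m := fun c hc => by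
      have := (isForest N).level_ch v c hc; omega
    rw [hx.on v (hF v (by omega)), bracket_shift_succ, bracket_shift_succ]
    constructor
    · exact one_div_one_add_anti hlam (Finset.prod_nonneg fun c _ => (hx.pos c).le)
        (Finset.prod_le_prod (fun c _ => (hx.pos c).le) fun c h => (ih c (hc c h)).2)
    · exact one_div_one_add_anti hlam (Finset.prod_nonneg fun c _ => (bracket_mem hlam _ _ _).1)
        (Finset.prod_le_prod (fun c _ => (bracket_mem hlam _ _ _).1) fun c h => (ih c (hc c h)).1)

/-- A vertex of `Ψ` at depth below `m` is not in the boundary, so all its neighbours lie in `Ψ`.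
Climbing to the root and descending again reaches every vertex of depth at most `m`. -/
theorem mem_of_level_le {Ψ : Finset (Vertex N)} {m : ℕ}
    (hb : ∀ w ∈ HardCore.boundary (graph N) Ψ, m ≤ level w) {u : Vertex N} (hu : u ∈ Ψ)
    (hum : level u < m) (v : Vertex N) (hv : level v ≤ m) : v ∈ Ψ := by
  have hnb : ∀ z w : Vertex N, z ∈ Ψ → level z < m → (graph N).Adj z w → w ∈ Ψ := by
    intro z w hz hzm hadj
    by_contra hw
    have : z ∈ HardCore.boundary (graph N) Ψ := by
      simp only [HardCore.boundary, Finset.mem_filter]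
      exact ⟨hz, w, hadj, hw⟩
    have := hb z this
    omega
  have hroot : root N ∈ Ψ := by
    induction hn : level u generalizing u with
    | zero => rwa [eq_root_of_level hn] at hu
    | succ n ih =>
      obtain ⟨z, hz, hl⟩ := exists_parent u (by omega)
      have hadj : (graph N).Adj u z := ((isForest N).adj u z).2 (Or.inr hz)
      exact ih (hnb u z hu hum hadj) (by omega) (by omega)
  induction hn : level v generalizing v with
  | zero => rwa [eq_root_of_level hn]
  | succ n ih =>
    obtain ⟨z, hz, hl⟩ := exists_parent v (by omega)
    have hadj : (graph N).Adj z v := ((isForest N).adj z v).2 (Or.inl hz)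
    exact hnb z v (ih z (by omega) (by omega)) (by omega) hadj

theorem subset_ball (Λ : Finset (Vertex N)) : Λ ⊆ ball N (Λ.sup level) := fun _ hv =>
  mem_ball.2 (Finset.le_sup (f := level) hv)

theorem boundary_subset (Ψ : Finset (Vertex N)) : HardCore.boundary (graph N) Ψ ⊆ Ψ := by
  classical exact Finset.filter_subset _ _

theorem tvDist_empty_le (hlam : 0 < lam) {Ψ B σ τ : Finset (Vertex N)}
    (hσ : HardCore.IsBoundaryCondition (graph N) B σ)
    (hτ : HardCore.IsBoundaryCondition (graph N) B τ) (hB : B ⊆ Ψ) :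
    HardCore.tvDist (graph N) lam Ψ B σ τ ∅ ≤ 0 := by
  obtain ⟨x, hx⟩ := HardCore.exists_isMessage (isForest N) hlam (HardCore.free (graph N) Ψ B σ)
  obtain ⟨y, hy⟩ := HardCore.exists_isMessage (isForest N) hlam (HardCore.free (graph N) Ψ B τ)
  have := HardCore.tvDist_le (Λ := ∅) (isForest N) hlam hσ hτ hB (by simp) hx hy
    (Λ' := ∅) (by simp) (by simp)
  simpa using this

open Filter Topology in
theorem wsm_of_tight (hlam : 0 < lam) (h : Tight lam N) : HardCore.WSM (graph N) lam := by
  intro Λ ε hε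
  rcases Λ.eq_empty_or_nonempty with rfl | ⟨u, hu⟩
  · exact ⟨0, fun Ψ _ σ τ hσ hτ _ =>
      (tvDist_empty_le hlam hσ hτ (boundary_subset Ψ)).trans hε.le⟩
  set r := Λ.sup level with hr
  have hlim : Tendsto (fun k => (2 : ℝ) ^ Λ.card * 2 ^ (ball N r).card * ∑ v ∈ ball N r,
      (bracket lam true k (shift v.1 N) - bracket lam false k (shift v.1 N))) atTop (𝓝 0) := by
    have : Tendsto (fun k => ∑ v ∈ ball N r,
        (bracket lam true k (shift v.1 N) - bracket lam false k (shift v.1 N))) atTop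
        (𝓝 (∑ v ∈ ball N r, 0)) := by
      refine tendsto_finsetSum _ fun v _ => ?_
      have h1 := (tendsto_bracket hlam true (shift v.1 N)).sub
        (tendsto_bracket hlam false (shift v.1 N))
      rwa [h.shift hlam v, sub_self] at h1
    simpa using this.const_mul ((2 : ℝ) ^ Λ.card * 2 ^ (ball N r).card)
  obtain ⟨k, hk⟩ := (hlim.eventually (ge_mem_nhds hε)).exists
  -- The depth of `u` may use up `r` of the distance, so the boundary lies at depth at least `k + r
  -- + 2`. Even after its neighbours are discarded, all vertices of depth at most `k + r` are free,
  -- which leaves `k` recursion steps below each vertex of the ball of radius `r`.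
  refine ⟨k + 2 * r + 2, fun Ψ hΨ σ τ hσ hτ hdist => ?_⟩
  have hb : ∀ w ∈ HardCore.boundary (graph N) Ψ, k + r + 2 ≤ level w := fun w hw => by
    have := le_level_of_le_setDist hdist hu (Finset.le_sup (f := level) hu) hw
    omega
  have hul : level u ≤ r := Finset.le_sup (f := level) hu
  have hin := mem_of_level_le hb (hΨ hu) (by omega)
  have hfree : ∀ ρ, HardCore.IsBoundaryCondition (graph N) (HardCore.boundary (graph N) Ψ) ρ →
      ∀ v : Vertex N, level v < k + r + 1 →
        v ∈ HardCore.free (graph N) Ψ (HardCore.boundary (graph N) Ψ) ρ := by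
    intro ρ hρ v hv
    refine HardCore.mem_free.2 ⟨hin v (by omega), fun hvb => ?_, fun w hw hadj => ?_⟩
    · have := hb v hvb; omega
    · have := hb w (hρ.1 hw)
      have := level_adj hadj
      omega
  have hΛd : ∀ ρ, HardCore.IsBoundaryCondition (graph N) (HardCore.boundary (graph N) Ψ) ρ →
      ∀ v ∈ Λ, v ∉ ρ := by
    intro ρ hρ v hv hvρ
    have := hb v (hρ.1 hvρ)
    have : level v ≤ r := Finset.le_sup (f := level) hv
    omega
  obtain ⟨x, hx⟩ := HardCore.exists_isMessage (isForest N) hlam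
    (HardCore.free (graph N) Ψ (HardCore.boundary (graph N) Ψ) σ)
  obtain ⟨y, hy⟩ := HardCore.exists_isMessage (isForest N) hlam
    (HardCore.free (graph N) Ψ (HardCore.boundary (graph N) Ψ) τ)
  refine (HardCore.tvDist_le (isForest N) hlam hσ hτ (boundary_subset Ψ) ?_ hx hy
    (ball_parent_closed r) (subset_ball Λ)).trans (le_trans ?_ hk)
  · ext v
    simp only [Finset.mem_inter]
    exact ⟨fun ⟨h1, h2⟩ => absurd h1 (hΛd σ hσ v h2), fun ⟨h1, h2⟩ => absurd h1 (hΛd τ hτ v h2)⟩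
  · refine mul_le_mul_of_nonneg_left (Finset.sum_le_sum fun v hv => ?_) (by positivity)
    have hvl := mem_ball.1 hv
    have h1 := bracket_message hlam hx (hfree σ hσ) k v (by omega)
    have h2 := bracket_message hlam hy (hfree τ hτ) k v (by omega)
    rw [abs_le]
    constructor <;> linarith [h1.1, h1.2, h2.1, h2.2]

/-- The limits solve the recursion exactly with the roles exchanged. Messages that start above the
upper limits are therefore alternately below the lower and above the upper limits at successive
levels, and no part of the gap is lost. -/
theorem bracketLim_message (hlam : 0 < lam) {F : Finset (Vertex N)} {x : Vertex N → ℝ} {m : ℕ}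
    (hx : HardCore.IsMessage children lam F x) (hF : ∀ v : Vertex N, level v < m → v ∈ F)
    (hm : ∀ v : Vertex N, level v = m → bracketLim lam true (shift v.1 N) ≤ x v) (k : ℕ)
    (v : Vertex N) (hv : level v + k = m) :
    (Even k → bracketLim lam true (shift v.1 N) ≤ x v) ∧
      (¬ Even k → x v ≤ bracketLim lam false (shift v.1 N)) := by
  induction k generalizing v with
  | zero => exact ⟨fun _ => hm v hv, fun h => absurd Even.zero h⟩
  | succ k ih =>
    have hc : ∀ c ∈ children v, level c + k = m := fun c hc => by
      have := (isForest N).level_ch v c hc; omega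
    rw [hx.on v (hF v (by omega)), bracketLim_shift hlam, bracketLim_shift hlam]
    rw [Nat.even_add_one, not_not]
    constructor
    · intro hk
      exact one_div_one_add_anti hlam (Finset.prod_nonneg fun c _ => (hx.pos c).le)
        (Finset.prod_le_prod (fun c _ => (hx.pos c).le) fun c h => (ih c (hc c h)).2 hk)
    · intro hk
      exact one_div_one_add_anti hlam (Finset.prod_nonneg fun c _ => (bracketLim_mem hlam _ _).1)
        (Finset.prod_le_prod (fun c _ => (bracketLim_mem hlam _ _).1)
          fun c h => (ih c (hc c h)).1 hk)

theorem mem_boundary_ball {n : ℕ} {v : Vertex N} :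
    v ∈ HardCore.boundary (graph N) (ball N n) ↔ level v = n ∧ (children v).Nonempty := by
  simp only [HardCore.boundary, Finset.mem_filter, mem_ball]
  constructor
  · rintro ⟨h, w, hadj, hw⟩
    have := level_adj hadj
    refine ⟨by omega, ?_⟩
    rcases ((isForest N).adj v w).1 hadj with h' | h'
    · exact ⟨w, h'⟩
    · have := (isForest N).level_ch w v h'
      omega
  · rintro ⟨h, w, hw⟩
    have := (isForest N).level_ch v w hw
    exact ⟨h.le, w, ((isForest N).adj v w).2 (Or.inl hw), by omega⟩

/-- On a ball of radius `n = R + 1`, the vacant boundary puts messages above the upper limits at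
depth `n`. The occupied boundary blocks its parents and does the same at depth `R`. The shift of one
level reverses parity, so the two messages reach the root on opposite sides of the gap. -/
theorem not_wsm_of_not_tight (hlam : 0 < lam) (h : ¬ Tight lam N) :
    ¬ HardCore.WSM (graph N) lam := by
  intro hW
  have hgap : 0 < bracketLim lam true N - bracketLim lam false N :=
    sub_pos.2 (lt_of_le_of_ne (bracketLim_le hlam N) h)
  obtain ⟨R, hR⟩ := hW {root N} ((bracketLim lam true N - bracketLim lam false N) / 4)
    (by linarith)
  set n := R + 1 with hn
  set B := HardCore.boundary (graph N) (ball N n) with hBdef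
  have hBl : ∀ v ∈ B, level v = n := fun v hv => (mem_boundary_ball.1 hv).1
  have hσ : HardCore.IsBoundaryCondition (graph N) B ∅ := ⟨Finset.empty_subset _, by simp⟩
  have hτ : HardCore.IsBoundaryCondition (graph N) B B := by
    refine ⟨Finset.Subset.refl _, fun u hu v hv _ hadj => ?_⟩
    have h1 := hBl u hu
    have h2 := hBl v hv
    have := level_adj hadj
    omega
  obtain ⟨x, hx⟩ := HardCore.exists_isMessage (isForest N) hlam
    (HardCore.free (graph N) (ball N n) B ∅)
  obtain ⟨y, hy⟩ := HardCore.exists_isMessage (isForest N) hlam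
    (HardCore.free (graph N) (ball N n) B B)
  -- Leaves at depth `n` have no neighbour outside the ball, hence are not frozen; at a free leaf
  -- the message equals both limits.
  have hleaf : ∀ (b : Bool) (F : Finset (Vertex N)) (z : Vertex N → ℝ) (v : Vertex N),
      HardCore.IsMessage children lam F z → v ∈ F → ¬ (children v).Nonempty →
      z v = bracketLim lam b (shift v.1 N) := by
    intro b F z v hz hv hc
    rw [hz.on v hv, bracketLim_shift hlam, Finset.not_nonempty_iff_eq_empty.1 hc]
    simp
  have hxm : ∀ v : Vertex N, level v = n → bracketLim lam true (shift v.1 N) ≤ x v := by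
    intro v hv
    by_cases hvF : v ∈ HardCore.free (graph N) (ball N n) B ∅
    · refine (hleaf true _ x v hx hvF fun hc => ?_).ge
      exact (HardCore.mem_free.1 hvF).2.1 (mem_boundary_ball.2 ⟨hv, hc⟩)
    · rw [hx.off v hvF]
      exact (bracketLim_mem hlam _ _).2
  -- A vertex at depth `R` is either blocked, with message 1, or has only leaves as children, in
  -- which case its message is exact.
  have hym : ∀ v : Vertex N, level v = R → bracketLim lam true (shift v.1 N) ≤ y v := by
    intro v hv
    by_cases hvF : v ∈ HardCore.free (graph N) (ball N n) B B
    · rw [hy.on v hvF, bracketLim_shift hlam]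
      refine le_of_eq ?_
      congr 3
      refine Finset.prod_congr rfl fun c hc => ?_
      have hcl := (isForest N).level_ch v c hc
      have hadj : (graph N).Adj v c := ((isForest N).adj v c).2 (Or.inl hc)
      have hcB : c ∉ B := fun hcB => (HardCore.mem_free.1 hvF).2.2 c hcB hadj.symm
      have hcc : ¬ (children c).Nonempty := fun h' =>
        hcB (mem_boundary_ball.2 ⟨by omega, h'⟩)
      refine (hleaf (!true) _ y c hy ?_ hcc).symm
      refine HardCore.mem_free.2 ⟨mem_ball.2 (by omega), hcB, fun u hu hadj' => ?_⟩
      have h1 := hBl u hu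
      have := level_adj hadj'
      omega
    · rw [hy.off v hvF]
      exact (bracketLim_mem hlam _ _).2
  have hxF : ∀ v : Vertex N, level v < n → v ∈ HardCore.free (graph N) (ball N n) B ∅ := by
    intro v hv
    refine HardCore.mem_free.2 ⟨mem_ball.2 hv.le, fun hvB => ?_, by simp⟩
    have := hBl v hvB
    omega
  have hyF : ∀ v : Vertex N, level v < R → v ∈ HardCore.free (graph N) (ball N n) B B := by
    intro v hv
    refine HardCore.mem_free.2 ⟨mem_ball.2 (by omega), fun hvB => ?_, fun u hu hadj => ?_⟩
    · have := hBl v hvB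
      omega
    · have := hBl u hu
      have := level_adj hadj
      omega
  have h1 := bracketLim_message hlam hx hxF hxm n (root N) (by simp [level, root])
  have h2 := bracketLim_message hlam hy hyF hym R (root N) (by simp [level, root])
  have hs : shift (root N).1 N = N := shift_nil N
  rw [hs] at h1 h2
  rw [hn, Nat.even_add_one, not_not] at h1
  have h3 : bracketLim lam true N - bracketLim lam false N ≤ |x (root N) - y (root N)| := by
    by_cases hE : Even R
    · have := h1.2 hE
      have := h2.1 hE
      exact le_trans (by linarith) (neg_le_abs _)
    · have := h1.1 hE
      have := h2.2 hE
      exact le_trans (by linarith) (le_abs_self _)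
  have hrB : root N ∉ B := fun hrB => by
    have := hBl _ hrB
    simp [level, root, hn] at this
  have h4 := HardCore.le_tvDist_singleton (isForest N) hlam hσ hτ (boundary_subset _) hx hy
    root_notMem_children hrB
  have h5 := hR (ball N n) (by simp [mem_ball, level, root]) ∅ B hσ hτ (by
    refine le_iInf₂ fun u hu => le_iInf₂ fun w hw => ?_
    rw [Finset.mem_singleton.1 hu]
    refine le_trans ?_ (level_le_edist w)
    rw [hBl w hw, hn]
    exact_mod_cast Nat.le_succ R)
  linarith

/-! ### Strong spatial mixing from contraction -/

/-- The number of vertices in generation `n`. -/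
def generation : ℕ → (List ℕ → ℕ) → ℕ
  | 0, _ => 1
  | n + 1, N => ∑ i ∈ Finset.range (N []), generation n (shift [i] N)

theorem generation_shift_succ (k : ℕ) (v : Vertex N) :
    generation (k + 1) (shift v.1 N) = ∑ c ∈ children v, generation k (shift c.1 N) := by
  rw [generation, shift_apply_nil, sum_children (fun l => generation k (shift l N))]
  simp only [shift_singleton_shift]

/-- A distance `D` between vacancy probabilities contracts by the factor `ρ` under
the hard-core recursion. -/
structure Contracts (lam : ℝ) (D : ℝ → ℝ → ℝ) (ρ M : ℝ) : Prop where
  self : ∀ s, D s s = 0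
  le : ∀ s t, 1 / (1 + lam) ≤ s → s ≤ 1 → 1 / (1 + lam) ≤ t → t ≤ 1 → D s t ≤ M
  separates : ∀ ε : ℝ, 0 < ε → ∃ δ : ℝ, 0 < δ ∧ ∀ s t, 1 / (1 + lam) ≤ s → s ≤ 1 →
    1 / (1 + lam) ≤ t → t ≤ 1 → D s t ≤ δ → |s - t| ≤ ε
  step : ∀ (ι : Type) (I : Finset ι) (f g : ι → ℝ),
    (∀ i ∈ I, 1 / (1 + lam) ≤ f i ∧ f i ≤ 1) → (∀ i ∈ I, 1 / (1 + lam) ≤ g i ∧ g i ≤ 1) →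
    D (1 / (1 + lam * ∏ i ∈ I, f i)) (1 / (1 + lam * ∏ i ∈ I, g i)) ≤
      ρ * ∑ i ∈ I, D (f i) (g i)

theorem message_ge (hlam : 0 < lam) {F : Finset (Vertex N)} {x : Vertex N → ℝ}
    (hx : HardCore.IsMessage children lam F x) (v : Vertex N) : 1 / (1 + lam) ≤ x v := by
  by_cases hv : v ∈ F
  · rw [hx.on v hv]
    have h := one_div_one_add_anti hlam (Finset.prod_nonneg fun c _ => (hx.pos c).le)
      (Finset.prod_le_one (s := children v) (fun c _ => (hx.pos c).le) fun c _ => hx.le_one c)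
    rwa [mul_one] at h
  · rw [hx.off v hv, div_le_one (by linarith)]
    linarith

/-- The discrepancy at `v` is spread over its descendants `k` generations below, each weighted by `ρ
^ k`. A vertex that is frozen or blocked is so on both sides, and contributes nothing. -/
theorem Contracts.message_le {D : ℝ → ℝ → ℝ} {ρ M : ℝ} (hD : Contracts lam D ρ M)
    (hρ : 0 ≤ ρ) (hM : 0 ≤ M)
    (hlam : 0 < lam) {F F' : Finset (Vertex N)} {x y : Vertex N → ℝ} {m : ℕ}
    (hx : HardCore.IsMessage children lam F x) (hy : HardCore.IsMessage children lam F' y)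
    (hF : ∀ v : Vertex N, level v < m → (v ∈ F ↔ v ∈ F')) (k : ℕ) (v : Vertex N)
    (hv : level v + k ≤ m) : D (x v) (y v) ≤ ρ ^ k * generation k (shift v.1 N) * M := by
  induction k generalizing v with
  | zero =>
    simpa [generation] using hD.le _ _ (message_ge hlam hx v) (hx.le_one v) (message_ge hlam hy v)
      (hy.le_one v)
  | succ k ih =>
    by_cases hvF : v ∈ F
    · have hvF' := (hF v (by omega)).1 hvF
      rw [hx.on v hvF, hy.on v hvF']
      refine (hD.step _ _ _ _ (fun c _ => ⟨message_ge hlam hx c, hx.le_one c⟩)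
        (fun c _ => ⟨message_ge hlam hy c, hy.le_one c⟩)).trans ?_
      have : ∑ c ∈ children v, D (x c) (y c) ≤
          ∑ c ∈ children v, ρ ^ k * generation k (shift c.1 N) * M :=
        Finset.sum_le_sum fun c hc => ih c (by
          have := (isForest N).level_ch v c hc; omega)
      refine (mul_le_mul_of_nonneg_left this hρ).trans_eq ?_
      rw [generation_shift_succ]
      push_cast
      rw [← Finset.sum_mul, ← Finset.mul_sum]
      ring
    · have hvF' := fun h => hvF ((hF v (by omega)).2 h)
      rw [hx.off v hvF, hy.off v hvF', hD.self]
      positivity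

open Filter Topology in
theorem Contracts.ssm {D : ℝ → ℝ → ℝ} {ρ M : ℝ} (hD : Contracts lam D ρ M) (hρ : 0 ≤ ρ)
    (hM : 0 ≤ M) (hlam : 0 < lam)
    (hgen : ∀ v, Tendsto (fun n => ρ ^ n * (generation n (shift v N) : ℝ)) atTop (𝓝 0)) :
    HardCore.SSM (graph N) lam := by
  classical
  intro Λ ε hε
  rcases Λ.eq_empty_or_nonempty with rfl | ⟨u, hu⟩
  · exact ⟨0, fun Ψ _ B _ hB σ τ hσ hτ _ => (tvDist_empty_le hlam hσ hτ hB).trans hε.le⟩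
  set r := Λ.sup level with hr
  set C : ℝ := 2 ^ Λ.card * 2 ^ (ball N r).card * ((ball N r).card + 1) with hC
  have hCpos : 0 < C := by positivity
  obtain ⟨δ, hδ, hsep⟩ := hD.separates (ε / C) (by positivity)
  have hev : ∀ᶠ k in atTop, ∀ v ∈ ball N r, ρ ^ k * generation k (shift v.1 N) * M ≤ δ := by
    rw [Filter.eventually_all_finset]
    intro v _
    have h1 := (hgen v.1).mul_const M
    rw [zero_mul] at h1
    exact h1.eventually (ge_mem_nhds hδ)
  obtain ⟨k, hk⟩ := hev.exists
  -- Here the whole ball need not be free, but `σ` and `τ` agree at depth below `k + r + 2`, and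
  -- hence the two free sets agree at depth at most `k + r`.
  refine ⟨k + 2 * r + 2, fun Ψ hΨ B _ hB σ τ hσ hτ hdist => ?_⟩
  have hb : ∀ w : Vertex N, level w < k + r + 2 → (w ∈ σ ↔ w ∈ τ) := by
    intro w hw
    by_contra hne
    have hmem : w ∈ symmDiff σ τ := by
      rw [Finset.mem_symmDiff]
      tauto
    have := le_level_of_le_setDist (C := symmDiff σ τ) (by convert hdist) hu
      (Finset.le_sup (f := level) hu) hmem
    omega
  have hfree : ∀ v : Vertex N, level v < k + r + 1 →
      (v ∈ HardCore.free (graph N) Ψ B σ ↔ v ∈ HardCore.free (graph N) Ψ B τ) := by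
    intro v hv
    rw [HardCore.mem_free, HardCore.mem_free]
    have : ∀ w, (graph N).Adj w v → (w ∈ σ ↔ w ∈ τ) := fun w hadj => by
      have := level_adj hadj
      exact hb w (by omega)
    refine and_congr_right fun _ => and_congr_right fun _ => forall_congr' fun w => ?_
    exact ⟨fun h hw hadj => h ((this w hadj).2 hw) hadj,
      fun h hw hadj => h ((this w hadj).1 hw) hadj⟩
  obtain ⟨x, hx⟩ := HardCore.exists_isMessage (isForest N) hlam
    (HardCore.free (graph N) Ψ B σ)
  obtain ⟨y, hy⟩ := HardCore.exists_isMessage (isForest N) hlam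
    (HardCore.free (graph N) Ψ B τ)
  refine (HardCore.tvDist_le (isForest N) hlam hσ hτ hB ?_ hx hy
    (ball_parent_closed r) (subset_ball Λ)).trans ?_
  · ext v
    simp only [Finset.mem_inter]
    refine and_congr_left fun hv => hb v ?_
    have : level v ≤ r := Finset.le_sup (f := level) hv
    omega
  · have hsum : ∑ v ∈ ball N r, |x v - y v| ≤ (ball N r).card * (ε / C) := by
      refine (Finset.sum_le_card_nsmul _ _ (ε / C) fun v hv => ?_).trans_eq (nsmul_eq_mul _ _)
      refine hsep _ _ (message_ge hlam hx v) (hx.le_one v) (message_ge hlam hy v) (hy.le_one v) ?_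
      have hvl := mem_ball.1 hv
      exact (hD.message_le hρ hM hlam hx hy hfree k v (by omega)).trans (hk v hv)
    calc (2 : ℝ) ^ Λ.card * 2 ^ (ball N r).card * ∑ v ∈ ball N r, |x v - y v|
        ≤ 2 ^ Λ.card * 2 ^ (ball N r).card * (((ball N r).card + 1) * (ε / C)) := by
          refine mul_le_mul_of_nonneg_left (hsum.trans ?_) (by positivity)
          exact mul_le_mul_of_nonneg_right (by linarith) (by positivity)
      _ = C * (ε / C) := by rw [hC]; ring
      _ = ε := by field_simp

end PoissonTree

/-- Disagreements are confined to the boundary, so they are at least as far away as the boundary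
itself. -/
theorem HardCore.SSM.wsm {V : Type*} {G : SimpleGraph V} {lam : ℝ} (h : HardCore.SSM G lam) :
    HardCore.WSM G lam := by
  classical
  intro Λ ε hε
  obtain ⟨R, hR⟩ := h Λ ε hε
  refine ⟨R, fun Ψ hΨ σ τ hσ hτ hdist =>
    hR Ψ hΨ _ (Finset.Subset.refl _) (Finset.filter_subset _ _) σ τ hσ hτ (hdist.trans ?_)⟩
  refine iInf₂_mono fun u _ => le_iInf₂ fun w hw => iInf₂_le w ?_
  rw [Finset.mem_symmDiff] at hw
  rcases hw with hw | hw
  · exact hσ.1 hw.1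
  · exact hτ.1 hw.1

namespace PoissonTree

/-! ### The branching property and first moments -/

instance (d : ℝ≥0) : IsProbabilityMeasure (law d) := by unfold law; infer_instance

theorem measurable_shift (v : List ℕ) : Measurable (shift v) := by
  unfold shift; fun_prop

/-- The tree whose root has `ω none []` children, at which the trees `ω (some i)` are planted. -/
def glue (ω : Option ℕ → List ℕ → ℕ) : List ℕ → ℕ := fun l => ω l.getLast? l.dropLast

theorem measurable_glue : Measurable glue := by
  unfold glue; fun_prop

theorem glue_nil (ω : Option ℕ → List ℕ → ℕ) : glue ω [] = ω none [] := rfl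

theorem shift_glue (ω : Option ℕ → List ℕ → ℕ) (i : ℕ) : shift [i] (glue ω) = ω (some i) := by
  funext w; simp [shift, glue]

/-- Labels grow at the head, so the last entry of a label names the child of the root above which it
lies. Splitting off that entry is injective; the glued counts are therefore distinct coordinates of
an independent family. -/
theorem map_glue (d : ℝ≥0) :
    (Measure.infinitePi (fun _ : Option ℕ => law d)).map glue = law d := by
  have hinj : Function.Injective (fun l : List ℕ => (l.getLast?, l.dropLast)) := by
    intro l l' h
    obtain ⟨h1, h2⟩ := Prod.mk.inj h
    rcases List.eq_nil_or_concat l with rfl | ⟨w, a, rfl⟩ <;>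
      rcases List.eq_nil_or_concat l' with rfl | ⟨w', a', rfl⟩ <;> simp_all
  have h1 := Measure.infinitePi_map_curry_symm
    (fun (_ : Option ℕ) (_ : List ℕ) => poissonMeasure d)
  have h2 := Measure.map_infinitePi_infinitePi_of_inj (f := fun l : List ℕ =>
    (l.getLast?, l.dropLast)) (P := fun _ : Option ℕ × List ℕ => poissonMeasure d) hinj
  rw [← h1, Measure.map_map (by fun_prop) (by fun_prop)] at h2
  exact h2

theorem map_shift (d : ℝ≥0) (v : List ℕ) : (law d).map (shift v) = law d :=
  Measure.map_infinitePi_infinitePi_of_inj (f := fun w : List ℕ => w ++ v)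
    (P := fun _ : List ℕ => poissonMeasure d) fun _ _ h => List.append_cancel_right h

/-- The branching property: the root count and the subtrees at the children are independent, and
each subtree has the law of the whole tree. It is read off from the glued model, where these are
different coordinates. -/
theorem lintegral_prod_shift (d : ℝ≥0) (k : ℕ) (f : ℕ → (List ℕ → ℕ) → ℝ≥0∞)
    (hf : ∀ i, Measurable (f i)) :
    ∫⁻ N, (if N [] = k then ∏ i ∈ Finset.range k, f i (shift [i] N) else 0) ∂(law d) =
      poissonMeasure d {k} * ∏ i ∈ Finset.range k, ∫⁻ N, f i N ∂(law d) := by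
  let X : Option ℕ → (List ℕ → ℕ) → ℝ≥0∞ := fun o N =>
    o.elim (if N [] = k then 1 else 0) (fun i => f i N)
  have hroot : MeasurableSet {N : List ℕ → ℕ | N [] = k} :=
    measurableSet_eq_fun (measurable_pi_apply _) measurable_const
  have hX : ∀ o, Measurable (X o) := by
    intro o
    cases o with
    | none => exact Measurable.ite hroot measurable_const measurable_const
    | some i => exact hf i
  have hmeas : Measurable (fun N : List ℕ → ℕ =>
      if N [] = k then ∏ i ∈ Finset.range k, f i (shift [i] N) else 0) :=
    Measurable.ite hroot (Finset.measurable_fun_prod _ fun i _ => (hf i).comp (measurable_shift _))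
      measurable_const
  have hind : iIndepFun (fun o (ω : Option ℕ → List ℕ → ℕ) => X o (ω o))
      (Measure.infinitePi (fun _ : Option ℕ => law d)) := iIndepFun_infinitePi hX
  have heval : ∀ o, ∫⁻ ω, X o (ω o) ∂(Measure.infinitePi (fun _ : Option ℕ => law d)) =
      ∫⁻ N, X o N ∂(law d) := fun o =>
    (measurePreserving_eval_infinitePi (fun _ : Option ℕ => law d) o).lintegral_comp (hX o)
  have hnone : ∫⁻ N, X none N ∂(law d) = poissonMeasure d {k} := by
    have h1 : (fun N => X none N) = Set.indicator {N : List ℕ → ℕ | N [] = k} 1 := by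
      funext N
      simp [X, Set.indicator_apply]
    rw [h1, lintegral_indicator_one hroot]
    have h2 := Measure.infinitePi_map_eval (fun _ : List ℕ => poissonMeasure d) []
    conv_rhs => rw [← h2]
    rw [Measure.map_apply (measurable_pi_apply _) (measurableSet_singleton _)]
    rfl
  conv_lhs => rw [← map_glue d]
  rw [lintegral_map hmeas measurable_glue]
  have hprod := lintegral_prod_eq_prod_lintegral_of_indepFun
    (insert none ((Finset.range k).map Function.Embedding.some)) _ hind
    (fun o => (hX o).comp (measurable_pi_apply o))
  have hnotMem : none ∉ (Finset.range k).map Function.Embedding.some := by simp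
  rw [Finset.prod_insert hnotMem, Finset.prod_map, heval, hnone] at hprod
  simp only [Function.Embedding.some_apply, heval] at hprod
  refine Eq.trans ?_ hprod
  refine lintegral_congr fun ω => ?_
  rw [Finset.prod_insert hnotMem, Finset.prod_map, glue_nil]
  simp only [shift_glue, X, Option.elim, Function.Embedding.some_apply]
  split_ifs <;> simp

theorem measurable_of_root {β : Type*} [MeasurableSpace β] {g : ℕ → (List ℕ → ℕ) → β}
    (hg : ∀ k, Measurable (g k)) : Measurable (fun N : List ℕ → ℕ => g (N []) N) := by
  have h : Measurable (fun p : ℕ × (List ℕ → ℕ) => g p.1 p.2) :=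
    measurable_from_prod_countable_right fun k => hg k
  have h' : Measurable (fun N : List ℕ → ℕ => (N [], N)) :=
    (measurable_pi_apply []).prodMk measurable_id
  exact h.comp h'

theorem lintegral_root (d : ℝ≥0) {g : ℕ → (List ℕ → ℕ) → ℝ≥0∞} (hg : ∀ k, Measurable (g k)) :
    ∫⁻ N, g (N []) N ∂(law d) = ∑' k, ∫⁻ N, (if N [] = k then g k N else 0) ∂(law d) := by
  rw [← lintegral_tsum]
  · refine lintegral_congr fun N => ?_
    rw [tsum_eq_single (N [])]
    · simp
    · intro k hk
      rw [if_neg (Ne.symm hk)]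
  · intro k
    exact (Measurable.ite (measurableSet_eq_fun (measurable_pi_apply _) measurable_const) (hg k)
      measurable_const).aemeasurable

theorem tsum_poisson_mul_pow (d : ℝ≥0) {t : ℝ} (ht : 0 ≤ t) :
    ∑' k, poissonMeasure d {k} * ENNReal.ofReal t ^ k = ENNReal.ofReal (Real.exp (d * (t - 1))) := by
  have h : HasSum (fun k : ℕ => Real.exp (-d) * (d : ℝ) ^ k / k.factorial * t ^ k)
      (Real.exp (d * (t - 1))) := by
    have h0 := (NormedSpace.expSeries_div_hasSum_exp ((d : ℝ) * t)).mul_left (Real.exp (-d))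
    rw [← Real.exp_eq_exp_ℝ, ← Real.exp_add] at h0
    rw [show (d : ℝ) * (t - 1) = -d + d * t by ring]
    have hfun : (fun k : ℕ => Real.exp (-d) * (d : ℝ) ^ k / k.factorial * t ^ k) =
        fun k : ℕ => Real.exp (-d) * (((d : ℝ) * t) ^ k / k.factorial) := by
      funext k
      rw [mul_pow]; ring
    rw [hfun]
    exact h0
  rw [← h.tsum_eq, ENNReal.ofReal_tsum_of_nonneg (fun k => by positivity) h.summable]
  refine tsum_congr fun k => ?_
  rw [poissonMeasure_singleton, ← ENNReal.ofReal_pow ht, ← ENNReal.ofReal_mul (by positivity)]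

/-- This is the derivative of the Poisson generating function, obtained from the size-bias identity
`(k + 1) p(k + 1) = d p(k)`. -/
theorem tsum_poisson_mul_nat_mul_pow (d : ℝ≥0) {t : ℝ} (ht : 0 ≤ t) :
    ∑' k : ℕ, poissonMeasure d {k} * (k * ENNReal.ofReal t ^ (k - 1)) =
      d * ENNReal.ofReal (Real.exp (d * (t - 1))) := by
  rw [tsum_eq_zero_add' ENNReal.summable]
  simp only [Nat.cast_zero, zero_mul, mul_zero, zero_add, Nat.add_sub_cancel]
  rw [← tsum_poisson_mul_pow d ht, ← ENNReal.tsum_mul_left]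
  refine tsum_congr fun k => ?_
  have h : poissonMeasure d {k + 1} * ((k + 1 : ℕ) : ℝ≥0∞) = d * poissonMeasure d {k} := by
    rw [poissonMeasure_singleton, poissonMeasure_singleton, ← ENNReal.ofReal_natCast,
      ← ENNReal.ofReal_mul (by positivity), ← ENNReal.ofReal_coe_nnreal,
      ← ENNReal.ofReal_mul (by positivity), Nat.factorial_succ]
    congr 1
    push_cast
    rw [pow_succ]
    field_simp
  rw [← mul_assoc, h, mul_assoc]

theorem lintegral_prod_children (d : ℝ≥0) {f : (List ℕ → ℕ) → ℝ≥0∞} (hf : Measurable f) {t : ℝ}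
    (ht : 0 ≤ t) (hft : ∫⁻ N, f N ∂(law d) = ENNReal.ofReal t) :
    ∫⁻ N, ∏ i ∈ Finset.range (N []), f (shift [i] N) ∂(law d) =
      ENNReal.ofReal (Real.exp (d * (t - 1))) := by
  rw [lintegral_root d (g := fun k N => ∏ i ∈ Finset.range k, f (shift [i] N)) fun k =>
    Finset.measurable_fun_prod _ fun i _ => hf.comp (measurable_shift _),
    ← tsum_poisson_mul_pow d ht]
  refine tsum_congr fun k => ?_
  rw [lintegral_prod_shift d k (fun _ => f) (fun _ => hf), hft]
  simp

/-- A marked child has a Poisson number of siblings with the same mean `d`. The choice `g = 1` gives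
generation sizes; `g = nonleaf` later detects families without leaves. -/
theorem lintegral_sum_children (d : ℝ≥0) {f g : (List ℕ → ℕ) → ℝ≥0∞} (hf : Measurable f)
    (hg : Measurable g) {t : ℝ} (ht : 0 ≤ t) (hgt : ∫⁻ N, g N ∂(law d) = ENNReal.ofReal t) :
    ∫⁻ N, ∑ i ∈ Finset.range (N []), f (shift [i] N) *
        ∏ j ∈ (Finset.range (N [])).erase i, g (shift [j] N) ∂(law d) =
      d * ENNReal.ofReal (Real.exp (d * (t - 1))) * ∫⁻ N, f N ∂(law d) := by
  have hmeas : ∀ k i, Measurable fun N : List ℕ → ℕ =>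
      f (shift [i] N) * ∏ j ∈ (Finset.range k).erase i, g (shift [j] N) := fun k i =>
    (hf.comp (measurable_shift _)).mul
      (Finset.measurable_fun_prod _ fun j _ => hg.comp (measurable_shift _))
  rw [lintegral_root d (g := fun k N => ∑ i ∈ Finset.range k, f (shift [i] N) *
    ∏ j ∈ (Finset.range k).erase i, g (shift [j] N)) fun k =>
    Finset.measurable_fun_sum _ fun i _ => hmeas k i,
    ← tsum_poisson_mul_nat_mul_pow d ht, ← ENNReal.tsum_mul_right]
  refine tsum_congr fun k => ?_
  have h1 : ∀ i ∈ Finset.range k, ∫⁻ N, (if N [] = k then f (shift [i] N) *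
      ∏ j ∈ (Finset.range k).erase i, g (shift [j] N) else 0) ∂(law d) =
      poissonMeasure d {k} * (ENNReal.ofReal t ^ (k - 1) * ∫⁻ N, f N ∂(law d)) := by
    intro i hi
    have h2 := lintegral_prod_shift d k (fun j => if j = i then f else g)
      (fun j => by split_ifs <;> assumption)
    rw [← Finset.mul_prod_erase _ _ hi] at h2
    simp only [if_true] at h2
    rw [Finset.prod_congr rfl (g := fun _ => ENNReal.ofReal t) fun j hj => by
      rw [if_neg (Finset.ne_of_mem_erase hj), hgt], Finset.prod_const,
      Finset.card_erase_of_mem hi, Finset.card_range, mul_comm (∫⁻ N, f N ∂(law d))] at h2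
    rw [← h2]
    refine lintegral_congr fun N => ?_
    rw [← Finset.mul_prod_erase _ _ hi]
    simp only [if_true]
    rw [Finset.prod_congr rfl (g := fun j => (if j = i then f else g) (shift [j] N)) fun j hj => by
      rw [if_neg (Finset.ne_of_mem_erase hj)]]
  have h3 : ∀ N : List ℕ → ℕ, (if N [] = k then ∑ i ∈ Finset.range k, f (shift [i] N) *
      ∏ j ∈ (Finset.range k).erase i, g (shift [j] N) else 0) =
      ∑ i ∈ Finset.range k, if N [] = k then f (shift [i] N) *
        ∏ j ∈ (Finset.range k).erase i, g (shift [j] N) else 0 := by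
    intro N
    split_ifs <;> simp
  simp only [h3]
  rw [lintegral_finsetSum _ fun i _ => Measurable.ite
    (measurableSet_eq_fun (measurable_pi_apply _) measurable_const) (hmeas k i) measurable_const,
    Finset.sum_congr rfl h1, Finset.sum_const, Finset.card_range, nsmul_eq_mul]
  ring

theorem measurable_generation (n : ℕ) : Measurable (generation n) := by
  induction n with
  | zero => exact measurable_const
  | succ n ih =>
    exact measurable_of_root (g := fun k N => ∑ i ∈ Finset.range k, generation n (shift [i] N))
      fun k => Finset.measurable_fun_sum _ fun i _ => ih.comp (measurable_shift _)

theorem lintegral_generation (d : ℝ≥0) (n : ℕ) :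
    ∫⁻ N, (generation n N : ℝ≥0∞) ∂(law d) = (d : ℝ≥0∞) ^ n := by
  induction n with
  | zero => simp [generation]
  | succ n ih =>
    have h := lintegral_sum_children d (f := fun N => (generation n N : ℝ≥0∞)) (g := fun _ => 1)
      (measurable_from_nat.comp (measurable_generation n)) measurable_const (t := 1) zero_le_one
      (by simp)
    simp only [Finset.prod_const_one, mul_one, sub_self, mul_zero, Real.exp_zero,
      ENNReal.ofReal_one, ih] at h
    rw [pow_succ', ← h]
    refine lintegral_congr fun N => ?_
    simp [generation]

open Filter Topology in
-- The expected sum over all `n` is a convergent geometric series, so almost surely the terms tend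
-- to 0. Each subtree has the same law and there are countably many labels.
theorem ae_tendsto_generation (d : ℝ≥0) {ρ : ℝ} (hρ : 0 ≤ ρ) (hd : ρ * d < 1) :
    ∀ᵐ N ∂(law d), ∀ v, Tendsto (fun n => ρ ^ n * (generation n (shift v N) : ℝ)) atTop (𝓝 0) := by
  have hmeas : ∀ n, Measurable fun N => ENNReal.ofReal (ρ ^ n) * (generation n N : ℝ≥0∞) :=
    fun n => (measurable_from_nat.comp (measurable_generation n)).const_mul _
  have hfin : ∫⁻ N, ∑' n, ENNReal.ofReal (ρ ^ n) * (generation n N : ℝ≥0∞) ∂(law d) ≠ ∞ := by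
    rw [lintegral_tsum fun n => (hmeas n).aemeasurable]
    have : ∀ n, ∫⁻ N, ENNReal.ofReal (ρ ^ n) * (generation n N : ℝ≥0∞) ∂(law d) =
        ENNReal.ofReal ((ρ * d) ^ n) := by
      intro n
      have hm : Measurable fun N => (generation n N : ℝ≥0∞) :=
        measurable_from_nat.comp (measurable_generation n)
      rw [lintegral_const_mul _ hm,
        lintegral_generation, mul_pow, ENNReal.ofReal_mul (by positivity),
        ENNReal.ofReal_pow d.coe_nonneg, ENNReal.ofReal_coe_nnreal]
    simp only [this]
    rw [← ENNReal.ofReal_tsum_of_nonneg (fun n => by positivity)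
      (summable_geometric_of_lt_one (by positivity) hd)]
    exact ENNReal.ofReal_ne_top
  have hroot : ∀ᵐ N ∂(law d),
      Tendsto (fun n => ρ ^ n * (generation n N : ℝ)) atTop (𝓝 0) := by
    filter_upwards [ae_lt_top (Measurable.tsum hmeas) hfin] with N hN
    have h := ENNReal.tendsto_atTop_zero_of_tsum_ne_top hN.ne
    have h' := (ENNReal.tendsto_toReal ENNReal.zero_ne_top).comp h
    rw [ENNReal.toReal_zero] at h'
    refine h'.congr fun n => ?_
    simp [ENNReal.toReal_mul, ENNReal.toReal_ofReal (pow_nonneg hρ n)]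
  rw [ae_all_iff]
  intro v
  rw [← map_shift d v] at hroot
  exact ae_of_ae_map (measurable_shift v).aemeasurable hroot

/-! ### Events determined by the subtrees at the children of the root -/

theorem isVertex_append_singleton (N : List ℕ → ℕ) (i : ℕ) (w : List ℕ) :
    IsVertex N (w ++ [i]) ↔ i < N [] ∧ IsVertex (shift [i] N) w := by
  induction w with
  | nil => simp [IsVertex]
  | cons j w ih => simp only [List.cons_append, IsVertex, ih, shift, and_assoc]

/-- The event that the tree is finite. -/
def finiteEvent : Set (List ℕ → ℕ) := {N | {v : List ℕ | IsVertex N v}.Finite}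

theorem mem_finiteEvent_iff (N : List ℕ → ℕ) :
    N ∈ finiteEvent ↔ ∀ i < N [], shift [i] N ∈ finiteEvent := by
  constructor
  · intro h i hi
    refine Set.Finite.of_finite_image (f := fun w : List ℕ => w ++ [i]) ?_
      (fun _ _ _ _ h => List.append_cancel_right h)
    refine Set.Finite.subset h ?_
    rintro _ ⟨w, hw, rfl⟩
    exact (isVertex_append_singleton N i w).2 ⟨hi, hw⟩
  · intro h
    have hfin : ({[]} ∪ ⋃ i ∈ Finset.range (N []),
        (fun w : List ℕ => w ++ [i]) '' {w | IsVertex (shift [i] N) w}).Finite :=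
      (Set.finite_singleton _).union ((Finset.range (N [])).finite_toSet.biUnion fun i hi =>
        (h i (by simpa using hi)).image _)
    refine hfin.subset fun v hv => ?_
    rcases List.eq_nil_or_concat v with rfl | ⟨w, i, rfl⟩
    · exact Or.inl rfl
    · rw [List.concat_eq_append] at hv ⊢
      obtain ⟨hi, hw⟩ := (isVertex_append_singleton N i w).1 hv
      exact Or.inr (Set.mem_biUnion (x := i) (by simpa using hi) ⟨w, hw, rfl⟩)

theorem measurableSet_isVertex (v : List ℕ) : MeasurableSet {N : List ℕ → ℕ | IsVertex N v} := by
  induction v with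
  | nil => simp [IsVertex]
  | cons i v ih =>
    exact ih.inter (measurableSet_lt measurable_const (measurable_pi_apply v))

theorem measurableSet_finiteEvent : MeasurableSet finiteEvent := by
  have : finiteEvent = ⋃ s : Finset (List ℕ), ⋂ v ∈ (s : Set (List ℕ))ᶜ,
      {N : List ℕ → ℕ | IsVertex N v}ᶜ := by
    ext N
    simp only [Set.mem_iUnion, Set.mem_iInter, Set.mem_compl_iff, Finset.mem_coe]
    constructor
    · intro h
      have h' : {v : List ℕ | IsVertex N v}.Finite := h
      exact ⟨h'.toFinset, fun v hv hN => hv (h'.mem_toFinset.2 hN)⟩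
    · rintro ⟨s, hs⟩
      refine s.finite_toSet.subset fun v hv => ?_
      by_contra hvs
      exact hs v hvs hv
  rw [this]
  exact MeasurableSet.iUnion fun s => MeasurableSet.biInter (Set.to_countable _)
    fun v _ => (measurableSet_isVertex v).compl

theorem infiniteEvent_eq : infiniteEvent = finiteEventᶜ := rfl

theorem law_real_eq_exp (d : ℝ≥0) {A : Set (List ℕ → ℕ)} (hA : MeasurableSet A)
    (h : ∀ N, N ∈ A ↔ ∀ i < N [], shift [i] N ∈ A) :
    (law d).real A = Real.exp (d * ((law d).real A - 1)) := by
  have h1 := lintegral_prod_children d (f := A.indicator 1) (measurable_one.indicator hA)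
    (t := (law d).real A) measureReal_nonneg (by
      rw [lintegral_indicator_one hA, ofReal_measureReal])
  have h2 : ∀ N : List ℕ → ℕ, ∏ i ∈ Finset.range (N []),
      (A.indicator 1 (shift [i] N) : ℝ≥0∞) = A.indicator 1 N := by
    intro N
    by_cases hN : N ∈ A
    · rw [Set.indicator_of_mem hN, Finset.prod_eq_one]
      · rfl
      · intro i hi
        rw [Set.indicator_of_mem ((h N).1 hN i (Finset.mem_range.1 hi))]
        rfl
    · rw [Set.indicator_of_notMem hN]
      rw [h N] at hN
      push Not at hN
      obtain ⟨i, hi, hni⟩ := hN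
      exact Finset.prod_eq_zero (Finset.mem_range.2 hi) (Set.indicator_of_notMem hni _)
  simp only [h2] at h1
  rw [lintegral_indicator_one hA] at h1
  conv_lhs => rw [measureReal_def, h1, ENNReal.toReal_ofReal (Real.exp_pos _).le]

/-- An event that holds for a tree if and only if it holds for all subtrees planted above the root,
that contains all finite trees, and that is not almost sure, fails for almost all infinite trees. -/
theorem ae_notMem_of_infinite (d : ℝ≥0) {A : Set (List ℕ → ℕ)} (hA : MeasurableSet A)
    (h : ∀ N, N ∈ A ↔ ∀ i < N [], shift [i] N ∈ A) (hfin : finiteEvent ⊆ A)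
    (hlt : (law d).real A < 1) : AlmostSurelyGivenInfinite d (fun N => N ∉ A) := by
  set q := (law d).real A with hq
  set e := (law d).real finiteEvent with he
  have h1 : q = Real.exp (d * (q - 1)) := law_real_eq_exp d hA h
  have h2 : e = Real.exp (d * (e - 1)) :=
    law_real_eq_exp d measurableSet_finiteEvent mem_finiteEvent_iff
  have hle : e ≤ q := measureReal_mono hfin
  have heq : e = q := by
    by_contra hne
    have hlt' : e < q := lt_of_le_of_ne hle hne
    have hd : (d : ℝ) ≠ 0 := by
      intro hd
      rw [hd, zero_mul, Real.exp_zero] at h1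
      linarith
    have hd' : 0 < (d : ℝ) := lt_of_le_of_ne d.2 (Ne.symm hd)
    -- Otherwise `e < q < 1` would be three solutions of `x = exp(d (x - 1))`. Both chords of the
    -- exponential would then have slope `1 / d`, against strict convexity.
    have hc := strictConvexOn_exp
    have hs := hc.slope_strict_mono_adjacent (x := d * (e - 1)) (y := d * (q - 1))
      (z := d * (1 - 1)) (Set.mem_univ _) (Set.mem_univ _) (by nlinarith) (by nlinarith)
    rw [← h1, ← h2, sub_self, mul_zero, Real.exp_zero, ← mul_sub, ← mul_zero (d : ℝ), ← mul_sub,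
      show (q - 1 - (e - 1)) = q - e by ring, show (0 - (q - 1)) = 1 - q by ring,
      div_mul_cancel_right₀ (by linarith), div_mul_cancel_right₀ (by linarith)] at hs
    exact lt_irrefl _ hs
  have hnull : law d (A \ finiteEvent) = 0 := by
    have h3 := measureReal_sdiff (μ := law d) hfin measurableSet_finiteEvent
    rw [← hq, ← he, heq, sub_self] at h3
    exact (measureReal_eq_zero_iff).1 h3
  unfold AlmostSurelyGivenInfinite
  have h4 : ∀ᵐ N ∂(law d)[|infiniteEvent], N ∉ A \ finiteEvent :=
    cond_absolutelyContinuous.ae_le (measure_eq_zero_iff_ae_notMem.1 hnull)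
  have h5 : ∀ᵐ N ∂(law d)[|infiniteEvent], N ∈ infiniteEvent :=
    ae_cond_mem (by rw [infiniteEvent_eq]; exact measurableSet_finiteEvent.compl)
  filter_upwards [h4, h5] with N h6 h7 h8
  exact h6 ⟨h8, h7⟩

theorem almostSurely_of_ae {d : ℝ≥0} {P : (List ℕ → ℕ) → Prop} (h : ∀ᵐ N ∂(law d), P N) :
    AlmostSurelyGivenInfinite d P :=
  cond_absolutelyContinuous.ae_le h

theorem measurable_bracket (lam : ℝ) (b : Bool) (k : ℕ) : Measurable (bracket lam b k) := by
  induction k generalizing b with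
  | zero => exact measurable_const
  | succ k ih =>
    refine measurable_of_root (g := fun n N =>
      1 / (1 + lam * ∏ i ∈ Finset.range n, bracket lam (!b) k (shift [i] N))) fun n => ?_
    have : Measurable fun N => ∏ i ∈ Finset.range n, bracket lam (!b) k (shift [i] N) :=
      Finset.measurable_fun_prod _ fun i _ => (ih _).comp (measurable_shift _)
    exact measurable_const.div (measurable_const.add (this.const_mul lam))

theorem measurable_bracketLim {lam : ℝ} (hlam : 0 < lam) (b : Bool) :
    Measurable (bracketLim lam b) :=
  measurable_of_tendsto_metrizable (measurable_bracket lam b)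
    (tendsto_pi_nhds.2 fun N => tendsto_bracket hlam b N)

/-! ### Contraction of the hard-core recursion in a hyperbolic potential -/

/-- The potential `arsinh √R` of a vacancy probability `s`, where `R = (1 - s) / s` is the
occupation ratio. -/
noncomputable def potential (s : ℝ) : ℝ := Real.arsinh (Real.sqrt ((1 - s) / s))

/-- With `u = potential s` this says that `tanh u ^ 2 = 1 - s` is the occupation probability, the
form in which it enters the derivative of the recursion. -/
theorem cosh_potential_sq {s : ℝ} (hs : 0 < s) (hs1 : s ≤ 1) :
    Real.cosh (potential s) ^ 2 = 1 / s := by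
  have h : 0 ≤ (1 - s) / s := div_nonneg (by linarith) hs.le
  rw [potential, Real.cosh_arsinh, Real.sq_sqrt h, Real.sq_sqrt (by positivity)]
  field_simp
  ring

theorem potential_mem {lam s : ℝ} (hlam : 0 < lam) (hs : 1 / (1 + lam) ≤ s) :
    0 ≤ potential s ∧ potential s ≤ Real.arsinh (Real.sqrt lam) := by
  refine ⟨Real.arsinh_nonneg_iff.2 (Real.sqrt_nonneg _), Real.arsinh_le_arsinh.2 ?_⟩
  have hs0 : 0 < s := lt_of_lt_of_le (by positivity) hs
  refine Real.sqrt_le_sqrt ?_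
  rw [div_le_iff₀ hs0]
  rw [div_le_iff₀ (by positivity)] at hs
  linarith

theorem abs_sub_le_potential {s t : ℝ} (hs : 0 < s) (hs1 : s ≤ 1) (ht : 0 < t) (ht1 : t ≤ 1) :
    |s - t| ≤ 2 * |potential s - potential t| := by
  have hinv : ∀ r : ℝ, 0 < r → r ≤ 1 → r = (Real.cosh (potential r) ^ 2)⁻¹ := by
    intro r hr hr1
    rw [cosh_potential_sq hr hr1, one_div, inv_inv]
  have hderiv : ∀ u : ℝ, HasDerivAt (fun u => (Real.cosh u ^ 2)⁻¹)
      (-(2 * Real.cosh u * Real.sinh u) / (Real.cosh u ^ 2) ^ 2) u := by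
    intro u
    have h1 := ((Real.hasDerivAt_cosh u).pow 2).inv (pow_pos (Real.cosh_pos u) 2).ne'
    refine HasDerivAt.congr_deriv (f := fun u => (Real.cosh u ^ 2)⁻¹) h1 ?_
    simp only [Pi.pow_apply, Nat.cast_ofNat, Nat.add_one_sub_one, pow_one]
  have hbound : ∀ u : ℝ, ‖-(2 * Real.cosh u * Real.sinh u) / (Real.cosh u ^ 2) ^ 2‖ ≤ 2 := by
    intro u
    have hc := Real.one_le_cosh u
    have hsq := Real.cosh_sq u
    have hs' : |Real.sinh u| ≤ Real.cosh u :=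
      abs_le_of_sq_le_sq (by linarith) (by linarith)
    rw [norm_div, norm_neg, Real.norm_eq_abs, Real.norm_eq_abs, abs_mul, abs_mul, abs_two,
      abs_of_pos (Real.cosh_pos u), abs_of_pos (pow_pos (pow_pos (Real.cosh_pos u) 2) 2),
      div_le_iff₀ (by positivity)]
    have h1 : Real.cosh u * |Real.sinh u| ≤ Real.cosh u * Real.cosh u :=
      mul_le_mul_of_nonneg_left hs' (by linarith)
    nlinarith [sq_nonneg (Real.cosh u), mul_self_nonneg (Real.cosh u ^ 2 - 1),
      one_le_pow₀ (n := 2) hc]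
  have h := convex_univ.norm_image_sub_le_of_norm_hasDerivWithin_le
    (f := fun u => (Real.cosh u ^ 2)⁻¹) (fun u _ => (hderiv u).hasDerivWithinAt)
    (fun u _ => hbound u) (Set.mem_univ (potential t)) (Set.mem_univ (potential s))
  simpa only [← hinv s hs hs1, ← hinv t ht ht1, Real.norm_eq_abs] using h

theorem potential_recursion {lam : ℝ} (hlam : 0 < lam) {ι : Type} (I : Finset ι) (f : ι → ℝ)
    (hf : ∀ i ∈ I, 0 < f i ∧ f i ≤ 1) :
    potential (1 / (1 + lam * ∏ i ∈ I, f i)) =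
      Real.arsinh (Real.sqrt lam * Real.exp (-∑ i ∈ I, Real.log (Real.cosh (potential (f i))))) := by
  have hp : 0 < ∏ i ∈ I, f i := Finset.prod_pos fun i hi => (hf i hi).1
  have h1 : (1 - 1 / (1 + lam * ∏ i ∈ I, f i)) / (1 / (1 + lam * ∏ i ∈ I, f i)) =
      lam * ∏ i ∈ I, f i := by
    have : 1 + lam * ∏ i ∈ I, f i ≠ 0 := by positivity
    field_simp
    ring
  have h2 : ∀ i ∈ I, Real.log (Real.cosh (potential (f i))) = -(Real.log (f i) / 2) := by
    intro i hi
    have h := congrArg Real.log (cosh_potential_sq (hf i hi).1 (hf i hi).2)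
    rw [Real.log_pow, one_div, Real.log_inv] at h
    push_cast at h
    linarith
  rw [potential, h1, Finset.sum_congr rfl h2, Finset.sum_neg_distrib, neg_neg, ← Finset.sum_div,
    ← Real.log_prod fun i hi => (hf i hi).1.ne', Real.sqrt_mul hlam.le, Real.exp_half,
    Real.exp_log hp]

theorem one_sub_tanh_sq (u : ℝ) : 1 - Real.tanh u ^ 2 = (Real.cosh u ^ 2)⁻¹ := by
  have h := Real.cosh_sq u
  have hc := (Real.cosh_pos u).ne'
  rw [Real.tanh_eq_sinh_div_cosh]
  field_simp
  linarith

/-- Mean value theorem for the hard-core recursion in the potential: `T i` are the square roots of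
the occupation probabilities of the children at an intermediate point, and `q` that of
the parent. -/
theorem exists_mean_value {lam : ℝ} (hlam : 0 < lam) {ι : Type} (I : Finset ι) (f g : ι → ℝ)
    (hf : ∀ i ∈ I, 1 / (1 + lam) ≤ f i ∧ f i ≤ 1) (hg : ∀ i ∈ I, 1 / (1 + lam) ≤ g i ∧ g i ≤ 1) :
    ∃ (T : ι → ℝ) (q z : ℝ), 0 ≤ q ∧ 0 ≤ z ∧ z = lam * ∏ i ∈ I, (1 - T i ^ 2) ∧
      q ^ 2 = z / (1 + z) ∧ (∀ i ∈ I, 0 ≤ T i ∧ 1 / (1 + lam) ≤ 1 - T i ^ 2) ∧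
      |potential (1 / (1 + lam * ∏ i ∈ I, f i)) - potential (1 / (1 + lam * ∏ i ∈ I, g i))| =
        q * |∑ i ∈ I, T i * (potential (f i) - potential (g i))| := by
  have hpos : 0 < 1 / (1 + lam) := by positivity
  set a : ι → ℝ := fun i => potential (f i) with ha
  set b : ι → ℝ := fun i => potential (g i) with hb
  set u : ℝ → ι → ℝ := fun t i => b i + t * (a i - b i) with hu
  -- Along the segment joining the two families of potentials, `arsinh (y t)` is the potential of
  -- the parent. Its derivative is, up to sign, `y / √(1 + y ^ 2)` times `∑ tanh(u i) * (a i - b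
  -- i)`.
  set y : ℝ → ℝ := fun t =>
    Real.sqrt lam * Real.exp (-∑ i ∈ I, Real.log (Real.cosh (u t i))) with hy
  have hy' : ∀ t, HasDerivAt y
      (-(y t * ∑ i ∈ I, Real.tanh (u t i) * (a i - b i))) t := by
    intro t
    have h1 : ∀ i ∈ I, HasDerivAt (fun t => Real.log (Real.cosh (u t i)))
        (Real.tanh (u t i) * (a i - b i)) t := by
      intro i _
      have h2 : HasDerivAt (fun t => u t i) (a i - b i) t := by
        simpa [hu] using ((hasDerivAt_id t).mul_const (a i - b i)).const_add (b i)
      have h3 := (h2.cosh).log (Real.cosh_pos _).ne'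
      refine h3.congr_deriv ?_
      rw [Real.tanh_eq_sinh_div_cosh]
      ring
    have h4 := ((HasDerivAt.fun_sum h1).neg.exp).const_mul (Real.sqrt lam)
    refine HasDerivAt.congr_deriv (f := y) h4 ?_
    simp only [hy, Pi.neg_apply]
    ring
  have hG : ∀ t, HasDerivAt (fun t => Real.arsinh (y t))
      ((Real.sqrt (1 + y t ^ 2))⁻¹ * -(y t * ∑ i ∈ I, Real.tanh (u t i) * (a i - b i))) t :=
    fun t => by simpa using (hy' t).arsinh
  obtain ⟨t, ht, hmv⟩ := exists_hasDerivAt_eq_slope (fun t => Real.arsinh (y t)) _ zero_lt_one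
    (fun t _ => (hG t).continuousAt.continuousWithinAt) (fun t _ => hG t)
  have hy0 : ∀ t, 0 ≤ y t := fun t => by positivity
  have hz : y t ^ 2 = lam * ∏ i ∈ I, (1 - Real.tanh (u t i) ^ 2) := by
    simp only [hy, mul_pow, Real.sq_sqrt hlam.le, ← Real.exp_nat_mul]
    congr 1
    rw [show ((2 : ℕ) : ℝ) * -∑ i ∈ I, Real.log (Real.cosh (u t i)) =
      ∑ i ∈ I, -(2 * Real.log (Real.cosh (u t i))) by
        rw [Finset.sum_neg_distrib, ← Finset.mul_sum]; push_cast; ring, Real.exp_sum]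
    refine Finset.prod_congr rfl fun i _ => ?_
    rw [one_sub_tanh_sq, Real.exp_neg, two_mul, Real.exp_add, Real.exp_log (Real.cosh_pos _), sq]
  refine ⟨fun i => Real.tanh (u t i), y t / Real.sqrt (1 + y t ^ 2), y t ^ 2,
    by have := hy0 t; positivity, by positivity, hz, ?_, ?_, ?_⟩
  · rw [div_pow, Real.sq_sqrt (by positivity)]
  · intro i hi
    have ha' := potential_mem hlam (hf i hi).1
    have hb' := potential_mem hlam (hg i hi).1
    have hu0 : 0 ≤ u t i := by
      simp only [hu]
      nlinarith [ht.1, ht.2, ha'.1, hb'.1]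
    have hu1 : u t i ≤ Real.arsinh (Real.sqrt lam) := by
      simp only [hu]
      nlinarith [ht.1, ht.2, ha'.2, hb'.2]
    have hcosh : Real.cosh (u t i) ^ 2 ≤ 1 + lam := by
      have h1 : Real.cosh (u t i) ≤ Real.cosh (Real.arsinh (Real.sqrt lam)) := by
        rw [Real.cosh_le_cosh, abs_of_nonneg hu0, abs_of_nonneg (hu0.trans hu1)]
        exact hu1
      rw [Real.cosh_arsinh, Real.sq_sqrt hlam.le] at h1
      have h2 := pow_le_pow_left₀ (Real.cosh_pos _).le h1 2
      rwa [Real.sq_sqrt (by positivity)] at h2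
    refine ⟨?_, ?_⟩
    · simp only [Real.tanh_eq_sinh_div_cosh]
      exact div_nonneg (Real.sinh_nonneg_iff.2 hu0) (Real.cosh_pos _).le
    · rw [one_sub_tanh_sq, one_div]
      exact inv_anti₀ (pow_pos (Real.cosh_pos _) 2) hcosh
  · have e1 : potential (1 / (1 + lam * ∏ i ∈ I, f i)) = Real.arsinh (y 1) := by
      rw [potential_recursion hlam I f fun i hi => ⟨hpos.trans_le (hf i hi).1, (hf i hi).2⟩]
      simp [hy, hu, ha]
    have e0 : potential (1 / (1 + lam * ∏ i ∈ I, g i)) = Real.arsinh (y 0) := by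
      rw [potential_recursion hlam I g fun i hi => ⟨hpos.trans_le (hg i hi).1, (hg i hi).2⟩]
      simp [hy, hu, hb]
    rw [sub_zero, div_one] at hmv
    rw [e1, e0, ← hmv, abs_mul, abs_neg, abs_mul, abs_of_nonneg (hy0 t),
      abs_of_nonneg (by positivity : 0 ≤ (Real.sqrt (1 + y t ^ 2))⁻¹)]
    ring

/-- Each coefficient satisfies `(q * T i) ^ 2 = z / (1 + z) * (1 - y)` with `y = 1 - T i ^ 2`. The
other children can only decrease `z`, so `z ≤ lam * y`, and a one-variable bound remains. -/
theorem contracts_abs {lam κ : ℝ} (hlam : 0 < lam)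
    (h : ∀ y, 1 / (1 + lam) ≤ y → y ≤ 1 → lam * y * (1 - y) ≤ κ * (1 + lam * y)) :
    Contracts lam (fun s t => |potential s - potential t|) (Real.sqrt κ)
      (Real.arsinh (Real.sqrt lam)) where
  self s := by simp
  le s t hs _ ht _ := by
    have h1 := potential_mem hlam hs
    have h2 := potential_mem hlam ht
    rw [abs_le]
    constructor <;> linarith
  separates ε hε := by
    refine ⟨ε / 2, by positivity, fun s t hs hs1 ht ht1 hd => ?_⟩
    have hpos : 0 < 1 / (1 + lam) := by positivity
    have := abs_sub_le_potential (hpos.trans_le hs) hs1 (hpos.trans_le ht) ht1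
    linarith
  step ι I f g hf hg := by
    classical
    obtain ⟨T, q, z, hq, hz0, hz, hqz, hT, heq⟩ := exists_mean_value hlam I f g hf hg
    simp only [heq]
    refine (mul_le_mul_of_nonneg_left (Finset.abs_sum_le_sum_abs _ _) hq).trans ?_
    rw [Finset.mul_sum, Finset.mul_sum]
    refine Finset.sum_le_sum fun i hi => ?_
    rw [abs_mul, ← mul_assoc, abs_of_nonneg (hT i hi).1]
    refine mul_le_mul_of_nonneg_right ?_ (abs_nonneg _)
    refine Real.le_sqrt_of_sq_le ?_
    have hpos : 0 < 1 / (1 + lam) := by positivity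
    set y := 1 - T i ^ 2 with hy
    have hy1 : y ≤ 1 := by rw [hy]; linarith [sq_nonneg (T i)]
    have hy0 : 0 < y := hpos.trans_le (hT i hi).2
    have hzy : z ≤ lam * y := by
      rw [hz]
      refine mul_le_mul_of_nonneg_left ?_ hlam.le
      rw [← Finset.mul_prod_erase I _ hi]
      refine mul_le_of_le_one_right hy0.le (Finset.prod_le_one (fun j hj => ?_) fun j hj => ?_)
      · exact (hpos.trans_le (hT j (Finset.mem_of_mem_erase hj)).2).le
      · linarith [sq_nonneg (T j)]
    have hfrac : z / (1 + z) ≤ lam * y / (1 + lam * y) := by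
      rw [div_le_div_iff₀ (by positivity) (by positivity)]
      nlinarith
    have hmain := h y (hT i hi).2 hy1
    have hTy : T i ^ 2 = 1 - y := by rw [hy]; ring
    rw [mul_pow, hqz, hTy]
    calc z / (1 + z) * (1 - y) ≤ lam * y / (1 + lam * y) * (1 - y) :=
          mul_le_mul_of_nonneg_right hfrac (by linarith)
      _ ≤ κ := by
          rw [div_mul_eq_mul_div, div_le_iff₀ (by positivity)]
          exact hmain

/-- Cauchy-Schwarz bounds the squared increment by `z / (1 + z) * s` times the sum of squares, with
`s = ∑ T i ^ 2`. Since `z ≤ lam * exp(-s)`, occupied children suppress their parent, and `s *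
exp(-s)` is at most `exp(-1)`. -/
theorem contracts_sq {lam : ℝ} (hlam : 0 < lam) :
    Contracts lam (fun s t => (potential s - potential t) ^ 2) (lam * Real.exp (-1))
      (Real.arsinh (Real.sqrt lam) ^ 2) where
  self s := by simp
  le s t hs _ ht _ := by
    have h1 := potential_mem hlam hs
    have h2 := potential_mem hlam ht
    refine sq_le_sq' ?_ ?_ <;> linarith
  separates ε hε := by
    refine ⟨(ε / 2) ^ 2, by positivity, fun s t hs hs1 ht ht1 hd => ?_⟩
    have hpos : 0 < 1 / (1 + lam) := by positivity
    have h1 := abs_sub_le_potential (hpos.trans_le hs) hs1 (hpos.trans_le ht) ht1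
    have h2 := abs_le_of_sq_le_sq hd (by positivity)
    linarith
  step ι I f g hf hg := by
    obtain ⟨T, q, z, hq, hz0, hz, hqz, hT, heq⟩ := exists_mean_value hlam I f g hf hg
    rw [← sq_abs, heq, mul_pow, sq_abs, hqz]
    have hcs := Finset.sum_mul_sq_le_sq_mul_sq I T fun i => potential (f i) - potential (g i)
    set s := ∑ i ∈ I, T i ^ 2 with hs
    set E := ∑ i ∈ I, (potential (f i) - potential (g i)) ^ 2 with hE
    have hs0 : 0 ≤ s := Finset.sum_nonneg fun i _ => sq_nonneg _
    have hE0 : 0 ≤ E := Finset.sum_nonneg fun i _ => sq_nonneg _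
    have hpos : 0 < 1 / (1 + lam) := by positivity
    have hzs : z ≤ lam * Real.exp (-s) := by
      rw [hz, hs, ← Finset.sum_neg_distrib, Real.exp_sum]
      refine mul_le_mul_of_nonneg_left (Finset.prod_le_prod
        (fun i hi => (hpos.trans_le (hT i hi).2).le) fun i _ => ?_) hlam.le
      linarith [Real.add_one_le_exp (-T i ^ 2)]
    have hse : Real.exp (-s) * s ≤ Real.exp (-1) := by
      have h1 : s ≤ Real.exp (s - 1) := by linarith [Real.add_one_le_exp (s - 1)]
      calc Real.exp (-s) * s ≤ Real.exp (-s) * Real.exp (s - 1) :=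
            mul_le_mul_of_nonneg_left h1 (Real.exp_pos _).le
        _ = Real.exp (-1) := by rw [← Real.exp_add]; congr 1; ring
    have hfrac : z / (1 + z) ≤ z := div_le_self hz0 (by linarith)
    calc z / (1 + z) * (∑ i ∈ I, T i * (potential (f i) - potential (g i))) ^ 2
        ≤ lam * Real.exp (-s) * (s * E) :=
          mul_le_mul (hfrac.trans hzs) hcs (sq_nonneg _) (by positivity)
      _ = lam * (Real.exp (-s) * s) * E := by ring
      _ ≤ lam * Real.exp (-1) * E :=
          mul_le_mul_of_nonneg_right (mul_le_mul_of_nonneg_left hse hlam.le) hE0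

theorem Contracts.ae_ssm {lam : ℝ} {D : ℝ → ℝ → ℝ} {ρ M : ℝ} (hD : Contracts lam D ρ M)
    (hρ : 0 ≤ ρ) (hM : 0 ≤ M) (hlam : 0 < lam) {d : ℝ≥0} (hd : ρ * d < 1) :
    AlmostSurelyGivenInfinite d (fun N => HardCore.SSM (graph N) lam) :=
  almostSurely_of_ae ((ae_tendsto_generation d hρ hd).mono fun _ hN => hD.ssm hρ hM hlam hN)

theorem ae_ssm_of_bound {lam κ : ℝ} (hlam : 0 < lam) {d : ℝ≥0} (hκ : 0 ≤ κ)
    (hκd : κ * (d : ℝ) ^ 2 < 1)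
    (h : ∀ y, 1 / (1 + lam) ≤ y → y ≤ 1 → lam * y * (1 - y) ≤ κ * (1 + lam * y)) :
    AlmostSurelyGivenInfinite d (fun N => HardCore.SSM (graph N) lam) := by
  refine (contracts_abs hlam h).ae_ssm (Real.sqrt_nonneg _)
    (Real.arsinh_nonneg_iff.2 (Real.sqrt_nonneg _)) hlam ?_
  refine lt_of_pow_lt_pow_left₀ 2 zero_le_one ?_
  rw [mul_pow, Real.sq_sqrt hκ, one_pow]
  exact hκd

theorem ae_ssm_of_lt {lam : ℝ} (hlam : 0 < lam) {d : ℝ≥0}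
    (h : lam < 4 * (d : ℝ) ^ 2 / ((d : ℝ) ^ 2 - 1) ^ 2) :
    AlmostSurelyGivenInfinite d (fun N => HardCore.SSM (graph N) lam) := by
  set w := Real.sqrt (1 + lam) with hw
  have hw2 : w ^ 2 = 1 + lam := Real.sq_sqrt (by linarith)
  have hw1 : 1 < w := by rw [hw, Real.lt_sqrt zero_le_one]; linarith
  -- This `κ` is the maximum of `lam * y * (1 - y) / (1 + lam * y)` over all `y` in `[0, 1]`,
  -- attained at `y = 1 / (w + 1)`. Solving `κ * d ^ 2 < 1` for `lam` gives the hypothesis when `d >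
  -- 1`; for `d ≤ 1` it is automatic.
  refine ae_ssm_of_bound (κ := (w - 1) / (w + 1)) hlam
    (div_nonneg (by linarith) (by linarith)) ?_ ?_
  · rw [div_mul_eq_mul_div, div_lt_one (by linarith)]
    by_cases hd : (d : ℝ) ^ 2 ≤ 1
    · nlinarith
    · push Not at hd
      have hD : 0 < (d : ℝ) ^ 2 - 1 := by linarith
      rw [lt_div_iff₀ (by positivity)] at h
      have h1 : (w * ((d : ℝ) ^ 2 - 1)) ^ 2 < ((d : ℝ) ^ 2 + 1) ^ 2 := by
        rw [mul_pow, hw2]; linarith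
      have h2 := lt_of_pow_lt_pow_left₀ 2 (by positivity) h1
      linarith
  · intro y _ _
    have hl : lam = (w - 1) * (w + 1) := by linarith
    rw [div_mul_eq_mul_div, le_div_iff₀ (by linarith)]
    have : 0 ≤ (w - 1) * ((w + 1) * y - 1) ^ 2 := mul_nonneg (by linarith) (sq_nonneg _)
    rw [hl]
    linarith

/-- Here `lam` is at most the golden ratio, so the unconstrained maximiser does not exceed the left
end `1 / (1 + lam)` of the admissible interval. The maximum is then taken at this end and gives a
smaller `κ`. -/
theorem ae_ssm_of_lt_large {lam : ℝ} (hlam : 0 < lam) {d : ℝ≥0}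
    (hd : Real.sqrt (2 + Real.sqrt 5) ≤ (d : ℝ))
    (h : lam < (3 + Real.sqrt (1 + 4 * (d : ℝ) ^ 2)) / (2 * (d : ℝ) ^ 2 - 4)) :
    AlmostSurelyGivenInfinite d (fun N => HardCore.SSM (graph N) lam) := by
  set D := (d : ℝ) ^ 2 with hD
  set s := Real.sqrt 5 with hs
  have hs2 : s ^ 2 = 5 := Real.sq_sqrt (by norm_num)
  have hs0 : 2 < s := by rw [hs, Real.lt_sqrt (by norm_num)]; norm_num
  have hDs : 2 + s ≤ D := by
    have h1 := pow_le_pow_left₀ (Real.sqrt_nonneg _) hd 2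
    rwa [Real.sq_sqrt (by linarith)] at h1
  -- The bound on `lam` is the larger root of this quadratic, which is `κ * D < 1` for the `κ`
  -- chosen below.
  have hquad : (D - 2) * lam ^ 2 < 3 * lam + 1 := by
    rw [lt_div_iff₀ (by linarith)] at h
    by_cases hneg : 2 * (D - 2) * lam - 3 < 0
    · nlinarith
    · push Not at hneg
      have h1 : 2 * (D - 2) * lam - 3 < Real.sqrt (1 + 4 * D) := by linarith
      have h2 := pow_lt_pow_left₀ h1 hneg two_ne_zero
      rw [Real.sq_sqrt (by linarith)] at h2
      have h3 : 0 < D - 2 := by linarith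
      have h4 : (D - 2) * ((D - 2) * lam ^ 2) < (D - 2) * (3 * lam + 1) := by linarith
      exact lt_of_mul_lt_mul_left h4 h3.le
  have hgold : lam ^ 2 ≤ 1 + lam := by
    by_contra hcon
    push Not at hcon
    have h1 : s * lam ^ 2 < 3 * lam + 1 := by nlinarith
    have h2 : (1 + s) / 2 < lam := by
      by_contra h3
      push Not at h3
      nlinarith
    -- The product expands to `s * lam ^ 2 - 3 * lam - 1`: at `D = 2 + √5` the quadratic vanishes
    -- exactly at the golden ratio.
    have h4 : 0 < (lam - (1 + s) / 2) * (s * lam + (s - 1) / 2) :=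
      mul_pos (by linarith) (by nlinarith)
    nlinarith
  refine ae_ssm_of_bound (κ := lam ^ 2 / ((1 + lam) * (1 + 2 * lam))) hlam (by positivity) ?_ ?_
  · rw [div_mul_eq_mul_div, div_lt_one (by positivity), ← hD]
    nlinarith
  · intro y hy _
    rw [div_le_iff₀ (by positivity)] at hy
    rw [div_mul_eq_mul_div, le_div_iff₀ (by positivity)]
    -- The difference to be bounded vanishes at the left end `y = 1 / (1 + lam)`; the remaining
    -- factor is nonnegative because `lam ^ 2 ≤ 1 + lam`.
    have h1 : 0 ≤ lam * ((y * (1 + lam) - 1) * ((1 + 2 * lam) * (y * (1 + lam)) - lam * (1 + lam))) := by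
      refine mul_nonneg hlam.le (mul_nonneg (by linarith) ?_)
      nlinarith
    have h2 : (1 + lam) * (lam ^ 2 * (1 + lam * y) - lam * y * (1 - y) * ((1 + lam) * (1 + 2 * lam))) =
        lam * ((y * (1 + lam) - 1) * ((1 + 2 * lam) * (y * (1 + lam)) - lam * (1 + lam))) := by
      ring
    have h3 := nonneg_of_mul_nonneg_right (h2 ▸ h1) (by linarith : 0 < 1 + lam)
    linarith

theorem ae_wsm_of_le {γ lam : ℝ} (hγ : 0 < γ) (hlam : 0 < lam) {d : ℝ≥0}
    (hd : 0 < (d : ℝ)) (h : lam ≤ (1 - γ) * Real.exp 1 / d) :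
    AlmostSurelyGivenInfinite d (fun N => HardCore.WSM (graph N) lam) := by
  have hs : AlmostSurelyGivenInfinite d (fun N => HardCore.SSM (graph N) lam) := by
    refine (contracts_sq hlam).ae_ssm (by positivity) (by positivity) hlam ?_
    rw [le_div_iff₀ hd] at h
    have h1 := mul_le_mul_of_nonneg_right h (Real.exp_pos (-1)).le
    rw [mul_assoc (1 - γ), ← Real.exp_add, add_neg_cancel, Real.exp_zero, mul_one] at h1
    linarith
  exact Filter.Eventually.mono hs fun N hN => hN.wsm

/-! ### Non-uniqueness for large fugacity -/

theorem tight_of_length_le {lam : ℝ} (hlam : 0 < lam) (n : ℕ) (N : List ℕ → ℕ)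
    (h : ∀ v, IsVertex N v → v.length ≤ n) : Tight lam N := by
  induction n generalizing N with
  | zero =>
    refine (tight_iff hlam N).2 fun i hi => ?_
    have := h ([] ++ [i]) ((isVertex_append_singleton N i []).2 ⟨hi, trivial⟩)
    simp at this
  | succ n ih =>
    refine (tight_iff hlam N).2 fun i hi => ih _ fun v hv => ?_
    have := h (v ++ [i]) ((isVertex_append_singleton N i v).2 ⟨hi, hv⟩)
    simpa using this

theorem finiteEvent_subset_tight {lam : ℝ} (hlam : 0 < lam) :
    finiteEvent ⊆ {N | Tight lam N} := by
  intro N hN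
  have hfin : {v : List ℕ | IsVertex N v}.Finite := hN
  exact tight_of_length_le hlam (hfin.toFinset.sup List.length) N fun v hv =>
    Finset.le_sup (f := List.length) (hfin.mem_toFinset.2 hv)

theorem integrable_bracket {lam : ℝ} (hlam : 0 < lam) (d : ℝ≥0) (b : Bool) (k : ℕ) :
    Integrable (bracket lam b k) (law d) :=
  Integrable.of_bound (measurable_bracket lam b k).aestronglyMeasurable 1
    (Filter.Eventually.of_forall fun N => by
      rw [Real.norm_eq_abs, abs_of_nonneg (bracket_mem hlam b k N).1]
      exact (bracket_mem hlam b k N).2)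

theorem measurable_prod_bracket (lam : ℝ) (b : Bool) (k : ℕ) :
    Measurable fun N : List ℕ → ℕ => ∏ i ∈ Finset.range (N []), bracket lam b k (shift [i] N) :=
  measurable_of_root (g := fun n N => ∏ i ∈ Finset.range n, bracket lam b k (shift [i] N))
    fun _ => Finset.measurable_fun_prod _ fun _ _ =>
      (measurable_bracket lam b k).comp (measurable_shift _)

theorem prod_bracket_mem {lam : ℝ} (hlam : 0 < lam) (b : Bool) (k : ℕ) (N : List ℕ → ℕ) :
    0 ≤ ∏ i ∈ Finset.range (N []), bracket lam b k (shift [i] N) ∧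
      ∏ i ∈ Finset.range (N []), bracket lam b k (shift [i] N) ≤ 1 :=
  ⟨Finset.prod_nonneg fun _ _ => (bracket_mem hlam _ _ _).1,
    Finset.prod_le_one (fun _ _ => (bracket_mem hlam _ _ _).1)
      fun _ _ => (bracket_mem hlam _ _ _).2⟩

theorem integrable_prod_bracket {lam : ℝ} (hlam : 0 < lam) (d : ℝ≥0) (b : Bool) (k : ℕ) :
    Integrable (fun N : List ℕ → ℕ => ∏ i ∈ Finset.range (N []), bracket lam b k (shift [i] N))
      (law d) :=
  Integrable.of_bound (measurable_prod_bracket lam b k).aestronglyMeasurable 1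
    (Filter.Eventually.of_forall fun N => by
      rw [Real.norm_eq_abs, abs_of_nonneg (prod_bracket_mem hlam b k N).1]
      exact (prod_bracket_mem hlam b k N).2)

/-- The Poisson generating function makes the mean of the product depend only on the mean of one
factor. -/
theorem integral_prod_bracket {lam : ℝ} (hlam : 0 < lam) (d : ℝ≥0) (b : Bool) (k : ℕ) :
    ∫ N, ∏ i ∈ Finset.range (N []), bracket lam b k (shift [i] N) ∂(law d) =
      Real.exp (-(d * (1 - ∫ N, bracket lam b k N ∂(law d)))) := by
  have h := lintegral_prod_children d (measurable_bracket lam b k).ennreal_ofReal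
    (t := ∫ N, bracket lam b k N ∂(law d))
    (integral_nonneg fun N => (bracket_mem hlam b k N).1)
    (ofReal_integral_eq_lintegral_ofReal (integrable_bracket hlam d b k)
      (Filter.Eventually.of_forall fun N => (bracket_mem hlam b k N).1)).symm
  rw [integral_eq_lintegral_of_nonneg_ae
    (Filter.Eventually.of_forall fun N => (prod_bracket_mem hlam b k N).1)
    (measurable_prod_bracket lam b k).aestronglyMeasurable]
  simp only [ENNReal.ofReal_prod_of_nonneg fun i _ => (bracket_mem hlam b k (shift [i] _)).1]
  rw [h, ENNReal.toReal_ofReal (Real.exp_pos _).le]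
  congr 1
  ring

/-- The mean occupation probability of the root after one step of the recursion. -/
theorem integral_bracket_succ {lam : ℝ} (hlam : 0 < lam) (d : ℝ≥0) (b : Bool) (k : ℕ) :
    lam / (1 + lam) * Real.exp (-(d * (1 - ∫ N, bracket lam (!b) k N ∂(law d)))) ≤
        1 - ∫ N, bracket lam b (k + 1) N ∂(law d) ∧
      1 - ∫ N, bracket lam b (k + 1) N ∂(law d) ≤
        lam * Real.exp (-(d * (1 - ∫ N, bracket lam (!b) k N ∂(law d)))) := by
  rw [← integral_prod_bracket hlam, ← integral_const_mul, ← integral_const_mul]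
  have h1 : 1 - ∫ N, bracket lam b (k + 1) N ∂(law d) =
      ∫ N, (1 - bracket lam b (k + 1) N) ∂(law d) := by
    rw [integral_sub (integrable_const 1) (integrable_bracket hlam d b _)]
    simp
  have hpt : ∀ N : List ℕ → ℕ,
      lam / (1 + lam) * ∏ i ∈ Finset.range (N []), bracket lam (!b) k (shift [i] N) ≤
        1 - bracket lam b (k + 1) N ∧ 1 - bracket lam b (k + 1) N ≤
        lam * ∏ i ∈ Finset.range (N []), bracket lam (!b) k (shift [i] N) := by
    intro N
    obtain ⟨h0, h1⟩ := prod_bracket_mem hlam (!b) k N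
    rw [bracket]
    set P := ∏ i ∈ Finset.range (N []), bracket lam (!b) k (shift [i] N)
    have hP : 0 ≤ lam * P := by positivity
    have hle : lam * P ≤ lam := mul_le_of_le_one_right hlam.le h1
    have e : 1 - 1 / (1 + lam * P) = lam * P / (1 + lam * P) := by
      field_simp
      ring
    rw [e]
    constructor
    · rw [div_mul_eq_mul_div, div_le_div_iff₀ (by positivity) (by positivity)]
      exact mul_le_mul_of_nonneg_left (by linarith) hP
    · exact div_le_self hP (by linarith)
  have hi : Integrable (fun N => 1 - bracket lam b (k + 1) N) (law d) :=
    (integrable_const 1).sub (integrable_bracket hlam d b _)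
  rw [h1]
  exact ⟨integral_mono ((integrable_prod_bracket hlam d _ k).const_mul _) hi fun N => (hpt N).1,
    integral_mono hi ((integrable_prod_bracket hlam d _ k).const_mul _) fun N => (hpt N).2⟩

/-- The two inequalities make the region "lower iterates have scaled mean occupation at least `r`,
upper ones at most `s`" invariant. The expected limits then differ, tightness is not almost sure,
and the zero-one law finishes. -/
theorem ae_not_tight {lam r s : ℝ} (hlam : 0 < lam) {d : ℝ≥0} (hd : 0 < (d : ℝ)) (hs : 0 ≤ s)
    (hsr : s < r) (hr : r ≤ d) (h1 : d * lam * Real.exp (-r) ≤ s)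
    (h2 : r ≤ d * (lam / (1 + lam)) * Real.exp (-s)) :
    AlmostSurelyGivenInfinite d (fun N => ¬ Tight lam N) := by
  have hinv : ∀ k, r ≤ d * (1 - ∫ N, bracket lam false k N ∂(law d)) ∧
      d * (1 - ∫ N, bracket lam true k N ∂(law d)) ≤ s := by
    intro k
    induction k with
    | zero => simpa [bracket] using ⟨hr, hs⟩
    | succ k ih =>
      have h3 := (integral_bracket_succ hlam d false k).1
      have h4 := (integral_bracket_succ hlam d true k).2
      simp only [Bool.not_false, Bool.not_true] at h3 h4
      have h5 := mul_le_mul_of_nonneg_left h3 hd.le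
      have h6 := mul_le_mul_of_nonneg_left h4 hd.le
      constructor
      · refine h2.trans (le_trans ?_ h5)
        rw [← mul_assoc]
        refine mul_le_mul_of_nonneg_left (Real.exp_le_exp.2 ?_) (by positivity)
        linarith [ih.2]
      · refine h6.trans (le_trans ?_ h1)
        rw [← mul_assoc]
        refine mul_le_mul_of_nonneg_left (Real.exp_le_exp.2 ?_) (by positivity)
        linarith [ih.1]
  have hlim : ∀ b, Filter.Tendsto (fun k => ∫ N, bracket lam b k N ∂(law d)) Filter.atTop
      (nhds (∫ N, bracketLim lam b N ∂(law d))) := by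
    intro b
    refine tendsto_integral_of_dominated_convergence (fun _ => 1)
      (fun k => (measurable_bracket lam b k).aestronglyMeasurable) (integrable_const 1)
      (fun k => Filter.Eventually.of_forall fun N => ?_)
      (Filter.Eventually.of_forall fun N => tendsto_bracket hlam b N)
    rw [Real.norm_eq_abs, abs_of_nonneg (bracket_mem hlam b k N).1]
    exact (bracket_mem hlam b k N).2
  have hgap : (r - s) ≤ d * (∫ N, bracketLim lam true N ∂(law d) -
      ∫ N, bracketLim lam false N ∂(law d)) := by
    refine ge_of_tendsto' (((hlim true).sub (hlim false)).const_mul (d : ℝ)) fun k => ?_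
    linarith [(hinv k).1, (hinv k).2]
  have hmeas : MeasurableSet {N | Tight lam N} :=
    measurableSet_eq_fun (measurable_bracketLim hlam false) (measurable_bracketLim hlam true)
  refine ae_notMem_of_infinite d hmeas (tight_iff hlam) (finiteEvent_subset_tight hlam)
    (lt_of_le_of_ne measureReal_le_one fun h => ?_)
  have hae : ∀ᵐ N ∂(law d), Tight lam N := by
    have h' : law d {N | Tight lam N} = 1 := by
      rw [← ofReal_measureReal, ← ENNReal.ofReal_one]
      exact congrArg _ h
    exact (mem_ae_iff_prob_eq_one hmeas).2 h'
  rw [integral_congr_ae hae, sub_self, mul_zero] at hgap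
  linarith

/-- The map `f x = c * exp(-x)` has a fixed point `s` with slope `-s`, and `c > e` forces `s > 1`.
Slightly above `s`, two steps of `f` move points further away. -/
theorem exists_expanding_point {c : ℝ} (hc : Real.exp 1 < c) :
    ∃ r, 0 < r ∧ c * Real.exp (-r) < r ∧ r < c * Real.exp (-(c * Real.exp (-r))) := by
  have hc1 : 1 < c := by linarith [Real.add_one_le_exp (1 : ℝ)]
  obtain ⟨s, hs, hsc⟩ : ∃ s ∈ Set.Icc 1 c, s * Real.exp s = c := by
    have hcont : ContinuousOn (fun s => s * Real.exp s) (Set.Icc 1 c) := by fun_prop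
    refine intermediate_value_Icc hc1.le hcont ⟨by simpa using hc.le, ?_⟩
    exact le_mul_of_one_le_right (by linarith) (Real.one_le_exp (by linarith))
  have hs1 : 1 < s := by
    refine lt_of_le_of_ne hs.1 fun h => ?_
    rw [← h, one_mul] at hsc
    linarith
  have hs0 : 0 < s := by linarith
  -- Then `1 + δ < s ^ 2`, so `f (s + δ) ≤ s / (1 + δ) < s - δ / s`, while `f (s - δ / s) = s *
  -- exp(δ / s) ≥ s + δ`.
  set δ := (s ^ 2 - 1) / 2 with hδ
  have hδ0 : 0 < δ := by nlinarith
  have hcr : c * Real.exp (-(s + δ)) = s * Real.exp (-δ) := by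
    rw [← hsc, mul_assoc, ← Real.exp_add]
    congr 2
    ring
  have hexp : Real.exp (-δ) ≤ 1 / (1 + δ) := by
    rw [Real.exp_neg, ← one_div]
    exact one_div_le_one_div_of_le (by linarith) (by linarith [Real.add_one_le_exp δ])
  have hexp1 : Real.exp (-δ) < 1 := by rw [Real.exp_lt_one_iff]; linarith
  refine ⟨s + δ, by linarith, ?_, ?_⟩
  · rw [hcr]
    nlinarith
  · rw [hcr]
    have h1 : s * Real.exp (-δ) < s - δ / s := by
      have h2 : s * Real.exp (-δ) ≤ s * (1 / (1 + δ)) := mul_le_mul_of_nonneg_left hexp hs0.le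
      refine h2.trans_lt ?_
      rw [mul_one_div, div_lt_iff₀ (by linarith), sub_mul, div_mul_eq_mul_div, lt_sub_iff_add_lt,
        ← lt_sub_iff_add_lt', div_lt_iff₀ hs0]
      nlinarith
    have h3 : s + δ ≤ s * Real.exp (δ / s) := by
      have := mul_le_mul_of_nonneg_left (Real.add_one_le_exp (δ / s)) hs0.le
      have e : s * (δ / s + 1) = s + δ := by field_simp; ring
      linarith
    refine h3.trans_lt ?_
    rw [← hsc, mul_assoc, ← Real.exp_add]
    refine mul_lt_mul_of_pos_left (Real.exp_lt_exp.2 ?_) hs0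
    linarith

theorem exists_ae_not_wsm {c : ℝ} (hc : Real.exp 1 < c) :
    ∃ d₀ : ℝ, ∀ d : ℝ≥0, d₀ < (d : ℝ) →
      AlmostSurelyGivenInfinite d (fun N => ¬ HardCore.WSM (graph N) (c / (d : ℝ))) := by
  obtain ⟨r, hr0, hsr, hr⟩ := exists_expanding_point hc
  have hc0 : 0 < c := (Real.exp_pos 1).trans hc
  set s := c * Real.exp (-r) with hs
  set g := c * Real.exp (-s) with hg
  -- The first bound starts the induction; the second absorbs the loss `1 / (1 + c / d)` in the
  -- lower inequality, thanks to `r < g`.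
  refine ⟨max r (c * r / (g - r)), fun d hd => ?_⟩
  have hdr : r < d := (le_max_left _ _).trans_lt hd
  have hd0 : 0 < (d : ℝ) := hr0.trans hdr
  have hdg : c * r < d * (g - r) := by
    have := (le_max_right _ _).trans_lt hd
    rwa [div_lt_iff₀ (by linarith)] at this
  have hlam : 0 < c / (d : ℝ) := by positivity
  refine Filter.Eventually.mono (ae_not_tight (r := r) (s := s) hlam hd0 (by positivity) hsr hdr.le
    (le_of_eq ?_) ?_) fun N hN => not_wsm_of_not_tight hlam hN
  · rw [mul_div_cancel₀ _ hd0.ne']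
  · have e : (d : ℝ) * (c / d / (1 + c / d)) * Real.exp (-s) = g * d / (d + c) := by
      rw [hg]
      field_simp
    rw [e, le_div_iff₀ (by positivity)]
    linarith

/-! ### Small mean: uniqueness at all fugacities -/

/-- The indicator of the root having a child. -/
def nonleaf (N : List ℕ → ℕ) : ℝ≥0 := if N [] = 0 then 0 else 1

/-- The sum over the non-leaves of generation `n` of `2 ^ (-k)`, where `k` is the number of proper
ancestors that have a leaf among their children. -/
noncomputable def damped : ℕ → (List ℕ → ℕ) → ℝ≥0
  | 0, N => nonleaf N
  | n + 1, N => (1 + ∏ i ∈ Finset.range (N []), nonleaf (shift [i] N)) / 2 *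
      ∑ i ∈ Finset.range (N []), damped n (shift [i] N)

theorem damped_eq_zero (n : ℕ) {N : List ℕ → ℕ} (h : N [] = 0) : damped n N = 0 := by
  cases n <;> simp [damped, nonleaf, h]

theorem measurable_nonleaf : Measurable nonleaf :=
  Measurable.ite (measurableSet_eq_fun (measurable_pi_apply _) measurable_const)
    measurable_const measurable_const

theorem measurable_damped (n : ℕ) : Measurable (damped n) := by
  induction n with
  | zero => exact measurable_nonleaf
  | succ n ih =>
    refine measurable_of_root (g := fun k N => (1 + ∏ i ∈ Finset.range k, nonleaf (shift [i] N)) / 2 *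
      ∑ i ∈ Finset.range k, damped n (shift [i] N)) fun k => ?_
    have h1 : Measurable fun N => ∏ i ∈ Finset.range k, nonleaf (shift [i] N) :=
      Finset.measurable_fun_prod _ fun i _ => measurable_nonleaf.comp (measurable_shift _)
    have h2 : Measurable fun N => ∑ i ∈ Finset.range k, damped n (shift [i] N) :=
      Finset.measurable_fun_sum _ fun i _ => ih.comp (measurable_shift _)
    exact ((h1.const_add 1).div_const 2).mul h2

theorem lintegral_nonleaf (d : ℝ≥0) :
    ∫⁻ N, (nonleaf N : ℝ≥0∞) ∂(law d) = ENNReal.ofReal (1 - Real.exp (-d)) := by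
  have hset : MeasurableSet {N : List ℕ → ℕ | N [] = 0} :=
    measurableSet_eq_fun (measurable_pi_apply _) measurable_const
  have h0 : law d {N : List ℕ → ℕ | N [] = 0} = ENNReal.ofReal (Real.exp (-d)) := by
    have h := lintegral_prod_shift d 0 (fun _ _ => 1) (fun _ => measurable_const)
    simp only [Finset.range_zero, Finset.prod_empty, mul_one, poissonMeasure_singleton, pow_zero,
      Nat.factorial_zero, Nat.cast_one, div_one] at h
    rw [← h, ← lintegral_indicator_one hset]
    refine lintegral_congr fun N => ?_
    simp [Set.indicator_apply]
  have h1 : ∀ N, (nonleaf N : ℝ≥0∞) = {N : List ℕ → ℕ | N [] = 0}ᶜ.indicator 1 N := by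
    intro N
    by_cases h : N [] = 0 <;> simp [nonleaf, h]
  simp only [h1]
  rw [lintegral_indicator_one hset.compl, prob_compl_eq_one_sub hset, h0,
    ENNReal.ofReal_sub _ (Real.exp_pos _).le, ENNReal.ofReal_one]

/-- The siblings of a marked child are all non-leaves with probability `exp(-d * exp(-d))`;
otherwise the contribution is halved. -/
theorem lintegral_damped_succ (d : ℝ≥0) (n : ℕ) :
    ∫⁻ N, (damped (n + 1) N : ℝ≥0∞) ∂(law d) =
      ENNReal.ofReal (d * ((1 + Real.exp (-(d * Real.exp (-d)))) / 2)) *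
        ∫⁻ N, (damped n N : ℝ≥0∞) ∂(law d) := by
  have hW : Measurable fun N => (damped n N : ℝ≥0∞) := (measurable_damped n).coe_nnreal_ennreal
  have hn : Measurable fun N => (nonleaf N : ℝ≥0∞) := measurable_nonleaf.coe_nnreal_ennreal
  have h1 := lintegral_sum_children d hW (g := fun _ => 1) measurable_const (t := 1) zero_le_one
    (by simp)
  have ht : 0 ≤ 1 - Real.exp (-(d : ℝ)) := by
    rw [sub_nonneg, Real.exp_le_one_iff]
    simp
  have h2 := lintegral_sum_children d hW hn ht (lintegral_nonleaf d)
  simp only [Finset.prod_const_one, mul_one, sub_self, mul_zero, Real.exp_zero,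
    ENNReal.ofReal_one] at h1
  have hpt : ∀ N : List ℕ → ℕ, (damped (n + 1) N : ℝ≥0∞) =
      2⁻¹ * (∑ i ∈ Finset.range (N []), (damped n (shift [i] N) : ℝ≥0∞) +
        ∑ i ∈ Finset.range (N []), (damped n (shift [i] N) : ℝ≥0∞) *
          ∏ j ∈ (Finset.range (N [])).erase i, (nonleaf (shift [j] N) : ℝ≥0∞)) := by
    intro N
    have hreal : damped (n + 1) N = 2⁻¹ * (∑ i ∈ Finset.range (N []), damped n (shift [i] N) +
        ∑ i ∈ Finset.range (N []), damped n (shift [i] N) *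
          ∏ j ∈ (Finset.range (N [])).erase i, nonleaf (shift [j] N)) := by
      have h3 : ∑ i ∈ Finset.range (N []), damped n (shift [i] N) *
          ∏ j ∈ (Finset.range (N [])).erase i, nonleaf (shift [j] N) =
          (∏ j ∈ Finset.range (N []), nonleaf (shift [j] N)) *
            ∑ i ∈ Finset.range (N []), damped n (shift [i] N) := by
        rw [Finset.mul_sum]
        refine Finset.sum_congr rfl fun i hi => ?_
        rw [← Finset.mul_prod_erase _ _ hi]
        -- A leaf has `damped n = 0`, so the factor `nonleaf` of the marked child itself may be
        -- dropped, which leaves only independent siblings.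
        by_cases h0 : shift [i] N [] = 0
        · rw [damped_eq_zero n h0]; simp
        · simp only [nonleaf, h0, if_false, one_mul]
          rw [mul_comm]
      rw [h3, damped, div_eq_mul_inv]
      ring
    rw [hreal]
    push_cast
    rfl
  have hm : Measurable fun N : List ℕ → ℕ =>
      ∑ i ∈ Finset.range (N []), (damped n (shift [i] N) : ℝ≥0∞) :=
    measurable_of_root (g := fun k N => ∑ i ∈ Finset.range k, (damped n (shift [i] N) : ℝ≥0∞))
      fun k => Finset.measurable_fun_sum _ fun i _ => hW.comp (measurable_shift _)
  have hm' : Measurable fun N : List ℕ → ℕ =>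
      ∑ i ∈ Finset.range (N []), (damped n (shift [i] N) : ℝ≥0∞) *
          ∏ j ∈ (Finset.range (N [])).erase i, (nonleaf (shift [j] N) : ℝ≥0∞) :=
    measurable_of_root (g := fun k N => ∑ i ∈ Finset.range k,
      (damped n (shift [i] N) : ℝ≥0∞) *
          ∏ j ∈ (Finset.range k).erase i, (nonleaf (shift [j] N) : ℝ≥0∞))
      fun k => Finset.measurable_fun_sum _ fun i _ => (hW.comp (measurable_shift _)).mul
        (Finset.measurable_fun_prod _ fun j _ => hn.comp (measurable_shift _))
  simp only [hpt]
  rw [lintegral_const_mul _ (hm.fun_add hm'), lintegral_add_left hm, h1, h2, ← add_mul, ← mul_assoc]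
  congr 1
  rw [show (d : ℝ) * (1 - Real.exp (-(d : ℝ)) - 1) = -(d * Real.exp (-(d : ℝ))) by ring,
    ENNReal.ofReal_mul d.coe_nonneg, ENNReal.ofReal_coe_nnreal,
    ENNReal.ofReal_div_of_pos two_pos, ENNReal.ofReal_add zero_le_one (Real.exp_pos _).le,
    ENNReal.ofReal_one, ENNReal.ofReal_ofNat, div_eq_mul_inv]
  ring

open Filter Topology in
theorem ae_tendsto_damped {d : ℝ≥0} (hd : d * ((1 + Real.exp (-(d * Real.exp (-d)))) / 2) < 1) :
    ∀ᵐ N ∂(law d), Tendsto (fun n => (damped n N : ℝ)) atTop (𝓝 0) := by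
  set K : ℝ := d * ((1 + Real.exp (-(d * Real.exp (-d)))) / 2) with hK
  have hK0 : 0 ≤ K := by positivity
  have hmeas : ∀ n, Measurable fun N => (damped n N : ℝ≥0∞) := fun n =>
    (measurable_damped n).coe_nnreal_ennreal
  have hpow : ∀ n, ∫⁻ N, (damped n N : ℝ≥0∞) ∂(law d) ≤ ENNReal.ofReal K ^ n := by
    intro n
    induction n with
    | zero =>
      simp only [damped, lintegral_nonleaf, pow_zero]
      rw [ENNReal.ofReal_le_one]
      linarith [Real.exp_pos (-(d : ℝ))]
    | succ n ih =>
      rw [lintegral_damped_succ, pow_succ']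
      gcongr
  have hfin : ∫⁻ N, ∑' n, (damped n N : ℝ≥0∞) ∂(law d) ≠ ∞ := by
    rw [lintegral_tsum fun n => (hmeas n).aemeasurable]
    refine ne_top_of_le_ne_top ?_ (ENNReal.tsum_le_tsum hpow)
    rw [ENNReal.tsum_geometric, ENNReal.inv_ne_top]
    exact (tsub_pos_of_lt (ENNReal.ofReal_lt_one.2 hd)).ne'
  filter_upwards [ae_lt_top (Measurable.tsum hmeas) hfin] with N hN
  have h := ENNReal.tendsto_atTop_zero_of_tsum_ne_top hN.ne
  have h' := (ENNReal.tendsto_toReal ENNReal.zero_ne_top).comp h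
  rw [ENNReal.toReal_zero] at h'
  exact h'.congr fun n => by simp

theorem log_one_add_sub_le {A B : ℝ} (hB : 0 < B) (hBA : B ≤ A) :
    Real.log (1 + A) - Real.log (1 + B) ≤ Real.log A - Real.log B := by
  have hA : 0 < A := hB.trans_le hBA
  have h : (1 + A) * B ≤ A * (1 + B) := by linarith
  have h1 := Real.log_le_log (by positivity) h
  rw [Real.log_mul (by positivity) hB.ne', Real.log_mul hA.ne' (by positivity)] at h1
  linarith

/-- As a function of `log A`, `log (1 + A)` has slope `A / (1 + A)`, at most 1/2 for `A ≤ 1`. -/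
theorem log_one_add_sub_le_half {A B : ℝ} (hB : 0 < B) (hBA : B ≤ A) (hA1 : A ≤ 1) :
    Real.log (1 + A) - Real.log (1 + B) ≤ 1 / 2 * (Real.log A - Real.log B) := by
  have hA : 0 < A := hB.trans_le hBA
  have h : (1 + A) ^ 2 * B ≤ A * (1 + B) ^ 2 := by
    have : 0 ≤ (A - B) * (1 - A * B) := mul_nonneg (by linarith) (by nlinarith)
    linarith
  have h1 := Real.log_le_log (by positivity) h
  rw [Real.log_mul (by positivity) hB.ne', Real.log_mul hA.ne' (by positivity), Real.log_pow,
    Real.log_pow] at h1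
  push_cast at h1
  linarith

/-- A leaf itself has no gap, which is why only non-leaves count; elsewhere the gap starts at no
more than `log (1 + lam)`. Each recursion step sums the gaps of the children, with a factor 1/2 when
one of them is a leaf. -/
theorem log_bracketLim_sub_le {lam : ℝ} (hlam : 0 < lam) (n : ℕ) (N : List ℕ → ℕ) :
    Real.log (bracketLim lam true N) - Real.log (bracketLim lam false N) ≤
      damped n N * Real.log (1 + lam) := by
  have hpos : ∀ b (M : List ℕ → ℕ),
      0 < ∏ i ∈ Finset.range (M []), bracketLim lam b (shift [i] M) :=
    fun b M => Finset.prod_pos fun i _ => bracketLim_pos hlam b _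
  have hexp : ∀ M : List ℕ → ℕ,
      Real.log (bracketLim lam true M) - Real.log (bracketLim lam false M) =
      Real.log (1 + lam * ∏ i ∈ Finset.range (M []), bracketLim lam true (shift [i] M)) -
        Real.log (1 + lam * ∏ i ∈ Finset.range (M []), bracketLim lam false (shift [i] M)) := by
    intro M
    rw [bracketLim_eq hlam true, bracketLim_eq hlam false, one_div, one_div, Real.log_inv,
      Real.log_inv]
    simp only [Bool.not_true, Bool.not_false]
    ring
  induction n generalizing N with
  | zero =>
    rw [hexp]
    by_cases h : N [] = 0
    · simp [h, damped, nonleaf]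
    · have h1 : Real.log (1 + lam * ∏ i ∈ Finset.range (N []), bracketLim lam true (shift [i] N)) ≤
          Real.log (1 + lam) := by
        refine Real.log_le_log (by have := hpos true N; positivity) ?_
        have := mul_le_of_le_one_right hlam.le (Finset.prod_le_one (s := Finset.range (N []))
          (fun i _ => (bracketLim_pos hlam true (shift [i] N)).le)
          fun i _ => (bracketLim_mem hlam true (shift [i] N)).2)
        linarith
      have h2 : 0 ≤ Real.log (1 + lam * ∏ i ∈ Finset.range (N []),
          bracketLim lam false (shift [i] N)) := by
        refine Real.log_nonneg ?_
        have := mul_pos hlam (hpos false N)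
        linarith
      simp only [damped, nonleaf, h, if_false, NNReal.coe_one, one_mul]
      linarith
  | succ n ih =>
    rw [hexp]
    set Q := ∏ i ∈ Finset.range (N []), bracketLim lam true (shift [i] N) with hQ
    set P := ∏ i ∈ Finset.range (N []), bracketLim lam false (shift [i] N) with hP
    have hQ0 : 0 < Q := hpos true N
    have hP0 : 0 < P := hpos false N
    have hPQ : P ≤ Q := Finset.prod_le_prod (fun i _ => (bracketLim_pos hlam false _).le)
      fun i _ => bracketLim_le hlam _
    have hsum : Real.log (lam * Q) - Real.log (lam * P) ≤
        (∑ i ∈ Finset.range (N []), (damped n (shift [i] N) : ℝ)) * Real.log (1 + lam) := by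
      rw [Real.log_mul hlam.ne' hQ0.ne', Real.log_mul hlam.ne' hP0.ne', hQ, hP,
        Real.log_prod fun i _ => (bracketLim_pos hlam true _).ne',
        Real.log_prod fun i _ => (bracketLim_pos hlam false _).ne', add_sub_add_left_eq_sub,
        ← Finset.sum_sub_distrib, Finset.sum_mul]
      exact Finset.sum_le_sum fun i _ => ih _
    have hle : lam * P ≤ lam * Q := mul_le_mul_of_nonneg_left hPQ hlam.le
    by_cases hleaf : ∃ i ∈ Finset.range (N []), shift [i] N [] = 0
    · obtain ⟨i, hi, h0⟩ := hleaf
      have hprod : ∏ j ∈ Finset.range (N []), nonleaf (shift [j] N) = 0 :=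
        Finset.prod_eq_zero hi (by simp [nonleaf, h0])
      -- The leaf child has message `1 / (1 + lam)`, so `lam * Q ≤ lam / (1 + lam) ≤ 1` for every
      -- fugacity.
      have hQ1 : lam * Q ≤ 1 := by
        have h1 : bracketLim lam true (shift [i] N) = 1 / (1 + lam) := by
          rw [bracketLim_eq hlam, h0]; simp
        have h2 : Q ≤ 1 / (1 + lam) := by
          rw [hQ, ← Finset.mul_prod_erase _ _ hi, h1]
          exact mul_le_of_le_one_right (by positivity) (Finset.prod_le_one
            (fun j _ => (bracketLim_pos hlam true _).le) fun j _ => (bracketLim_mem hlam true _).2)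
        rw [le_div_iff₀ (by positivity)] at h2
        linarith
      have h3 := log_one_add_sub_le_half (mul_pos hlam hP0) hle hQ1
      simp only [damped, hprod, add_zero]
      push_cast
      linarith
    · push Not at hleaf
      have hprod : ∏ j ∈ Finset.range (N []), nonleaf (shift [j] N) = 1 :=
        Finset.prod_eq_one fun j hj => by simp [nonleaf, hleaf j hj]
      have h3 := log_one_add_sub_le (mul_pos hlam hP0) hle
      simp only [damped, hprod]
      push_cast
      linarith

/-- The process `damped` does not involve `lam`, so one null set serves all fugacities at once. -/
theorem ae_forall_wsm {d : ℝ≥0} (hd : d * ((1 + Real.exp (-(d * Real.exp (-d)))) / 2) < 1) :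
    AlmostSurelyGivenInfinite d (fun N => ∀ lam : ℝ, 0 < lam → HardCore.WSM (graph N) lam) := by
  refine almostSurely_of_ae ((ae_tendsto_damped hd).mono fun N hN lam hlam => ?_)
  refine wsm_of_tight hlam ((bracketLim_le hlam N).antisymm ?_)
  have h := ge_of_tendsto' (hN.mul_const (Real.log (1 + lam)))
    fun n => log_bracketLim_sub_le hlam n N
  rw [zero_mul] at h
  exact (Real.log_le_log_iff (bracketLim_pos hlam true N) (bracketLim_pos hlam false N)).1
    (by linarith)

/-! ### The threshold `d*`: monotonicity and numerics -/

/-- The growth rate that governs uniqueness at all fugacities. -/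
noncomputable def meanFactor (x : ℝ) : ℝ := x * ((1 + Real.exp (-(x * Real.exp (-x)))) / 2)

theorem strictMonoOn_meanFactor : StrictMonoOn meanFactor (Set.Ici 0) := by
  have hderiv : ∀ x, HasDerivAt meanFactor
      ((1 + Real.exp (-(x * Real.exp (-x))) * (1 - x * (1 - x) * Real.exp (-x))) / 2) x := by
    intro x
    have h1 : HasDerivAt (fun x : ℝ => x * Real.exp (-x))
        (1 * Real.exp (-x) + x * (Real.exp (-x) * -1)) x :=
      (hasDerivAt_id x).mul (hasDerivAt_neg x).exp
    have h2 := (hasDerivAt_id x).mul (((h1.neg.exp).const_add 1).div_const 2)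
    refine HasDerivAt.congr_deriv (f := meanFactor) h2 ?_
    simp only [id, Pi.neg_apply]
    ring
  refine strictMonoOn_of_deriv_pos (convex_Ici 0)
    (fun x _ => (hderiv x).continuousAt.continuousWithinAt) fun x hx => ?_
  rw [interior_Ici] at hx
  have hx0 : 0 < x := hx
  rw [(hderiv x).deriv]
  have he : Real.exp (-x) ≤ 1 := by rw [Real.exp_le_one_iff]; linarith
  have he0 := Real.exp_pos (-x)
  have hE := Real.exp_pos (-(x * Real.exp (-x)))
  have h3 : x * (1 - x) * Real.exp (-x) ≤ 1 := by nlinarith [sq_nonneg (x - 1 / 2)]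
  have h4 : 0 ≤ Real.exp (-(x * Real.exp (-x))) * (1 - x * (1 - x) * Real.exp (-x)) :=
    mul_nonneg hE.le (by linarith)
  linarith

theorem continuous_meanFactor : Continuous meanFactor := by
  unfold meanFactor; fun_prop

theorem meanFactor_lt_one : meanFactor 1.179 < 1 := by
  have h1 : Real.exp 1.179 ≤ 3.257 := by
    -- The Taylor upper bound needs an argument in `[0, 1]`, hence the split `exp 1.179 = exp 1 *
    -- exp 0.179`. The final comparison has a margin of only about `2e-5`, which dictates the
    -- digits.
    have ha := Real.exp_bound' (x := 0.179) (by norm_num) (by norm_num) (n := 4) (by norm_num)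
    have hb : Real.exp 0.179 ≤ 1.198 := ha.trans (by norm_num [Finset.sum_range_succ, Nat.factorial])
    have hc := Real.exp_one_lt_d9
    calc Real.exp 1.179 = Real.exp 1 * Real.exp 0.179 := by rw [← Real.exp_add]; norm_num
      _ ≤ 2.7182818286 * 1.198 := mul_le_mul hc.le hb (Real.exp_pos _).le (by norm_num)
      _ ≤ 3.257 := by norm_num
  have h2 : (0.36198 : ℝ) ≤ 1.179 * Real.exp (-1.179) := by
    rw [Real.exp_neg, ← div_eq_mul_inv, le_div_iff₀ (Real.exp_pos _)]
    linarith
  have h3 : (1.4361 : ℝ) ≤ Real.exp 0.36198 :=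
    le_trans (by norm_num [Finset.sum_range_succ, Nat.factorial])
      (Real.sum_le_exp_of_nonneg (by norm_num) 6)
  have h4 : Real.exp (-(1.179 * Real.exp (-1.179))) ≤ 1 / 1.4361 := by
    rw [Real.exp_neg, ← one_div]
    exact one_div_le_one_div_of_le (by norm_num) (h3.trans (Real.exp_le_exp.2 h2))
  have h5 : (1 : ℝ) / 1.4361 < 2 / 1.179 - 1 := by norm_num
  unfold meanFactor
  linarith

theorem one_lt_meanFactor : 1 < meanFactor 1.18 := by
  have h1 : 3.254 ≤ Real.exp 1.18 :=
    le_trans (by norm_num [Finset.sum_range_succ, Nat.factorial])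
      (Real.sum_le_exp_of_nonneg (by norm_num) 9)
  have h2 : 1.18 * Real.exp (-1.18) ≤ (0.3627 : ℝ) := by
    rw [Real.exp_neg, ← div_eq_mul_inv, div_le_iff₀ (Real.exp_pos _)]
    linarith
  have h3 : Real.exp 0.3627 ≤ (1.438 : ℝ) :=
    (Real.exp_bound' (x := 0.3627) (by norm_num) (by norm_num) (n := 5) (by norm_num)).trans
      (by norm_num [Finset.sum_range_succ, Nat.factorial])
  have h4 : 1 / 1.438 ≤ Real.exp (-(1.18 * Real.exp (-1.18))) := by
    rw [Real.exp_neg, ← one_div]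
    exact one_div_le_one_div_of_le (Real.exp_pos _) ((Real.exp_le_exp.2 h2).trans h3)
  have h5 : (2 : ℝ) / 1.18 - 1 < 1 / 1.438 := by norm_num
  unfold meanFactor
  linarith

theorem exists_threshold :
    ∃ dstar : ℝ, 1.179 < dstar ∧ dstar < 1.18 ∧ ∀ x : ℝ, 0 < x → (meanFactor x < 1 ↔ x < dstar) := by
  obtain ⟨y, hy, hy1⟩ := intermediate_value_Ioo (by norm_num : (1.179 : ℝ) ≤ 1.18)
    continuous_meanFactor.continuousOn ⟨meanFactor_lt_one, one_lt_meanFactor⟩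
  refine ⟨y, hy.1, hy.2, fun x hx => ?_⟩
  rw [← hy1]
  exact strictMonoOn_meanFactor.lt_iff_lt (Set.mem_Ici.2 hx.le)
    (Set.mem_Ici.2 (by linarith [hy.1]))

end PoissonTree

theorem theorem2 :
    -- small mean: weak spatial mixing for all finite fugacities
    (∃ dstar : ℝ, 1.179 < dstar ∧ dstar < 1.18 ∧
      (∀ x : ℝ, 0 < x →
        ((1 + Real.exp (-(x * Real.exp (-x)))) / 2 < 1 / x ↔ x < dstar)) ∧
      ∀ d : ℝ≥0, 0 < d → (d : ℝ) < dstar →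
        PoissonTree.AlmostSurelyGivenInfinite d
          (fun N => ∀ lam : ℝ, 0 < lam → HardCore.WSM (PoissonTree.graph N) lam)) ∧
    -- small fugacity: strong spatial mixing
    (∀ d : ℝ≥0, 0 < d → ∀ lam : ℝ, 0 < lam →
      lam < (if (d : ℝ) < Real.sqrt (2 + Real.sqrt 5)
        then 4 * (d : ℝ) ^ 2 / ((d : ℝ) ^ 2 - 1) ^ 2
        else (3 + Real.sqrt (1 + 4 * (d : ℝ) ^ 2)) / (2 * (d : ℝ) ^ 2 - 4)) →
      PoissonTree.AlmostSurelyGivenInfinite d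
        (fun N => HardCore.SSM (PoissonTree.graph N) lam)) ∧
    -- large mean, fugacity at most `(1 - γ) e / d`: weak spatial mixing
    (∀ γ : ℝ, 0 < γ → γ < 1 → ∃ d₀ : ℝ, ∀ d : ℝ≥0, d₀ < (d : ℝ) → ∀ lam : ℝ, 0 < lam →
      lam ≤ (1 - γ) * Real.exp 1 / (d : ℝ) →
      PoissonTree.AlmostSurelyGivenInfinite d
        (fun N => HardCore.WSM (PoissonTree.graph N) lam)) ∧
    -- large mean, fugacity `c / d` with `c > e`: no weak spatial mixing
    (∀ c : ℝ, Real.exp 1 < c → ∃ d₀ : ℝ, ∀ d : ℝ≥0, d₀ < (d : ℝ) →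
      PoissonTree.AlmostSurelyGivenInfinite d
        (fun N => ¬ HardCore.WSM (PoissonTree.graph N) (c / (d : ℝ)))) := by
  refine ⟨?_, ?_, ?_, fun c hc => PoissonTree.exists_ae_not_wsm hc⟩
  · obtain ⟨y, hy1, hy2, hy⟩ := PoissonTree.exists_threshold
    refine ⟨y, hy1, hy2, fun x hx => ?_, fun d hd hdy => PoissonTree.ae_forall_wsm ?_⟩
    · rw [← hy x hx, lt_div_iff₀' hx]
      rfl
    · exact (hy d hd).2 hdy
  · intro d _ lam hlam h
    split_ifs at h with hd
    · exact PoissonTree.ae_ssm_of_lt hlam h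
    · exact PoissonTree.ae_ssm_of_lt_large hlam (not_lt.1 hd) h
  · intro γ hγ _
    -- The contraction of squares works for every positive `d`, so no largeness is needed.
    exact ⟨0, fun d hd lam hlam h => PoissonTree.ae_wsm_of_le hγ hlam hd h⟩
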